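/- Let $\mathbb F_q$ be a finite field, let $r,m\ge 1$ be coprime integers with $m$ not divisible by the characteristic of $\mathbb F_q$, and let $\alpha_1,\dots,\alpha_r\in\mathbb F_q$ be pairwise distinct. Let $F=\mathbb F_q(x,y)$ be the function field over $\mathbb F_q$ (with $y$ transcendental over $\mathbb F_q$) defined by $$\prod_{i=1}^r (y-\alpha_i)=x^m ,$$ and let $g$ be its genus, that is, the maximum of $\deg D+1-\ell(D)$ over all divisors $D$ of $F/\mathbb F_q$. A divisor $D$ is called non-special if $\ell(D)=\deg D+1-g$. For $a,b\in\mathbb F_q$ with $\prod_{i}(b-\alpha_i)=a^m$ let $P_{ab}$ be the unique place of $F$ at which $x$ and $y$ take the values $a$ and $b$, and let $P_\infty$ be the unique place at which $x$ or $y$ has a pole. (These places exist and are unique, and the maximum defining $g$ exists.) Put $\gamma=m-1-\lfloor m/r\rfloor$ and, for $1\le j\le\gamma$, let $l_j=r-\lfloor rj/m\rfloor$, $s_j=l_j-l_{j+1}$ if $j<\gamma$, and $s_\gamma=l_\gamma-1$. Let $b_{j_i}$ $(1\le j\le \gamma,\ 1\le i\le s_j)$ be pairwise distinct elements of $\{\alpha_1,\dots,\alpha_r\}$.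 Then for every place $P$ that is either $P_\infty$ or a point $P_{ab}$ with $a,b\in\mathbb F_q$ such that $a\ne 0$ or $b\neq b_{j_i}$ for all $j,i$, the divisor $$A=\Bigl(\sum_{j=1}^{\gamma} j\sum_{i=1}^{s_j}P_{0b_{j_i}}\Bigr)-P$$ is non-special of degree $g-1$ (an empty sum is $0$). In particular, for every point $P_{ab}$ with $a,b\in\mathbb F_q$ and $a\neq 0$ there is a non-special divisor of degree $g-1$ whose support is contained in $\mathrm{Supp}((x)_0)\cup\{P_{ab}\}$ and contains $P_{ab}$. -/

import Mathlib

open scoped WithZero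

noncomputable section

namespace KummerCurve

/-- A place of the function field `F / k`, given by its normalized discrete valuation, written
multiplicatively: `val f = exp (-v_P(f))` for `f ≠ 0`, and `val 0 = 0`. -/
@[ext]
structure Place (k F : Type*) [Field k] [Field F] [Algebra k F] where
  val : Valuation F ℤᵐ⁰
  surjective : Function.Surjective val
  trivial_on : ∀ c : k, c ≠ 0 → val (algebraMap k F c) = 1

section

variable {k F : Type*} [Field k] [Field F] [Algebra k F]

theorem Place.val_algebraMap_le (P : Place k F) (c : k) : P.val (algebraMap k F c) ≤ 1 := by
  by_cases hc : c = 0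
  · simp [hc]
  · exact (P.trivial_on c hc).le

/-- The valuation ring `O_P = {f : v_P(f) ≥ 0}` as a `k`-algebra. -/
def Place.ring (P : Place k F) : Subalgebra k F where
  carrier := {f | P.val f ≤ 1}
  mul_mem' {a b} ha hb := by
    simp only [Set.mem_ofPred_eq, map_mul] at *
    exact mul_le_one' ha hb
  add_mem' {_ _} ha hb := P.val.map_add_le ha hb
  algebraMap_mem' c := P.val_algebraMap_le c

/-- The maximal ideal `{f : v_P(f) > 0}` of `O_P`. -/
def Place.maxIdeal (P : Place k F) : Ideal P.ring where
  carrier := {f | P.val (f : F) < 1}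
  add_mem' {_ _} ha hb := P.val.map_add_lt ha hb
  zero_mem' := by simp
  smul_mem' c f hf := by
    have hc : P.val (c : F) ≤ 1 := c.2
    simp only [Set.mem_ofPred_eq, smul_eq_mul, MulMemClass.coe_mul, map_mul] at *
    exact mul_lt_one_of_nonneg_of_lt_one_right hc zero_le hf

/-- The degree of a place: the degree over `k` of its residue field `O_P / m_P`. -/
def Place.degree (P : Place k F) : ℕ := Module.finrank k (P.ring ⧸ P.maxIdeal)

/-- `P` is a place above the affine point `(a, b)`: the functions `x` and `y` take the values
`a` and `b` at `P`. -/
def Place.IsAt (P : Place k F) (x y : F) (a b : k) : Prop :=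
  P.val (x - algebraMap k F a) < 1 ∧ P.val (y - algebraMap k F b) < 1

/-- `P` is at infinity with respect to the affine coordinates `x`, `y`: one of them has a
pole at `P`. -/
def Place.IsAtInfinity (P : Place k F) (x y : F) : Prop :=
  1 < P.val x ∨ 1 < P.val y

/-- The support of the zero divisor `(f)_0` of a nonzero function: the set of its zeros. -/
def zeroSupport (k : Type*) {F : Type*} [Field k] [Field F] [Algebra k F] (f : F) :
    Set (Place k F) :=
  {P | P.val f < 1}

end

/-- Divisors: finite formal sums of places with integer coefficients. -/
abbrev Divisor (k F : Type*) [Field k] [Field F] [Algebra k F] := Place k F →₀ ℤ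

section

variable {k F : Type*} [Field k] [Field F] [Algebra k F]

/-- The degree of a divisor. -/
def Divisor.deg (D : Divisor k F) : ℤ := D.sum fun P n => n * (P.degree : ℤ)

/-- The Riemann–Roch space `L(D) = {f : f = 0 or v_P(f) ≥ -D(P) for all P}`. -/
def Divisor.L (D : Divisor k F) : Submodule k F where
  carrier := {f | ∀ P : Place k F, P.val f ≤ WithZero.exp (D P)}
  add_mem' {_ _} ha hb P := P.val.map_add_le (ha P) (hb P)
  zero_mem' P := by simp
  smul_mem' c f hf P := by
    rw [Algebra.smul_def, map_mul]
    exact (mul_le_of_le_one_left' (P.val_algebraMap_le c)).trans (hf P)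

/-- `ℓ(D) = dim_k L(D)`. -/
def Divisor.ell (D : Divisor k F) : ℕ := Module.finrank k D.L

end

/-- The numbers `deg D + 1 - ℓ(D)`, for all divisors `D`. -/
def genusSet (k F : Type*) [Field k] [Field F] [Algebra k F] : Set ℤ :=
  Set.range fun D : Divisor k F => D.deg + 1 - (D.ell : ℤ)

/-- The genus of `F / k`: the maximum of `deg D + 1 - ℓ(D)` over all divisors `D`. -/
def genus (k F : Type*) [Field k] [Field F] [Algebra k F] : ℤ := sSup (genusSet k F)

/-- The index of speciality `i(D) = ℓ(D) - (deg D + 1 - g)`. -/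
def Divisor.specialityIndex {k F : Type*} [Field k] [Field F] [Algebra k F]
    (D : Divisor k F) : ℤ :=
  (D.ell : ℤ) - (D.deg + 1 - genus k F)

/-- `D` is non-special if `i(D) = 0`. -/
def Divisor.IsNonspecial {k F : Type*} [Field k] [Field F] [Algebra k F]
    (D : Divisor k F) : Prop :=
  D.specialityIndex = 0

/-- `γ = m - 1 - ⌊m / r⌋`. For `r = 1` this integer is `-1`; the truncated value `0` gives the
same (empty) range `1 ≤ j ≤ γ`. -/
def gam (r m : ℕ) : ℕ := m - 1 - m / r

/-- `l_j = r - ⌊r j / m⌋`. -/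
def lnum (r m j : ℕ) : ℕ := r - r * j / m

/-- `s_j = l_j - l_{j+1}` for `j < γ`, and `s_γ = l_γ - 1`. -/
def snum (r m j : ℕ) : ℕ :=
  if j < gam r m then lnum r m j - lnum r m (j + 1) else lnum r m j - 1

/-- The index set of the pairs `(j, i)` with `1 ≤ j ≤ γ` and `1 ≤ i ≤ s_j`. -/
def idx (r m : ℕ) : Finset (Σ _ : ℕ, ℕ) :=
  (Finset.Icc 1 (gam r m)).sigma fun j => Finset.Icc 1 (snum r m j)

end KummerCurve

end

noncomputable section

namespace KummerCurve

open IsDedekindDomain WithZero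

/-! ### Places as discrete valuations -/

section Places

variable {k F : Type*} [Field k] [Field F] [Algebra k F]

/-! Write `E` for the divisor `∑ j, j ∑ i, P_{0 b_{j_i}}` and `g₀ = ∑_{0<j<m} (l_j - 1)`
(`kummerGenus`). Everything follows from three facts: `deg E = g₀` (`deg_poleDivisor`), `L(E) = k`
(`eq_algebraMap_of_mem_L_poleDivisor`), and `deg D + 1 - ℓ(D) ≤ g₀` for every `D` (`riemann`). If
`P` is rational and outside the support of `E`, a function in `L(E - P)` is a constant vanishing at
`P`, so `ℓ(E - P) = 0` while `deg (E - P) = g₀ - 1`. Taking `P = P_∞` shows that the bound `g₀` is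
attained, so the genus is `g₀`; then every such `E - P` has degree `g - 1` and no sections, hence is
non-special.

The local input is that `x` and `y` have poles of order `r` and `m` at `P_∞`, and that at `P_{0
α_t}` the function `x` is a uniformizer while `y - α_t` vanishes to order `m`. At these places
functions of `y` alone have orders divisible by `m` and the order of `x` is prime to `m`. So the
terms of a sum `∑_{i<m} c_i(y) x^i` have distinct orders and cannot cancel
(`Place.val_monomial_le`).

For `L(E) = k`, subtract from `f ∈ L(E)` its value at `P_∞`, clear denominators by a power of `x^m`,
and expand the result in powers of `x`. The orders at the zeros of `x` force the coefficient
polynomials to have many roots, the zero at `P_∞` bounds their degrees, and the definition of `s_j`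
makes the two incompatible (`eq_zero_of_val_le`).

For Riemann's inequality, `deg D - ℓ(D)` is monotone in `D` and constant on linear equivalence
classes. Every `D` lies below a divisor equivalent to a multiple of `P_∞`, thanks to the divisors of
the functions `p(y)`. On multiples of `P_∞` it suffices to count the monomials `y^j x^i`.

Existence of places comes from primes of the integral closure of `k[z]` in `F`. Uniqueness and
rationality come together from `HasLeading`: if at all places of a set every nonzero function has
the form `c π^n` to first order, with `c` and `n` common to the set, then the set has at most one
element. -/

theorem Place.exists_val_eq_exp (P : Place k F) {f : F} (hf : f ≠ 0) :
    ∃ n : ℤ, P.val f = exp n :=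
  ⟨log (P.val f), (exp_log ((Valuation.ne_zero_iff _).2 hf)).symm⟩

theorem Place.exists_eq_exp (P : Place k F) (n : ℤ) : ∃ f : F, f ≠ 0 ∧ P.val f = exp n := by
  obtain ⟨f, hf⟩ := P.surjective (exp n)
  exact ⟨f, (Valuation.ne_zero_iff P.val).1 (hf ▸ exp_ne_zero), hf⟩

/-- An element whose powers exhaust all values of a place is a uniformizer. -/
theorem Place.val_eq_exp_neg_one (P : Place k F) {π : F} (hπ : P.val π < 1)
    (h : ∀ f : F, f ≠ 0 → ∃ n : ℤ, P.val f = P.val π ^ n) : P.val π = exp (-1) := by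
  obtain ⟨f, hf0, hf⟩ := P.exists_eq_exp (-1)
  obtain ⟨n, hn⟩ := h f hf0
  have hπ0 : π ≠ 0 := by
    rintro rfl
    rw [map_zero] at hn
    rcases eq_or_ne n 0 with rfl | hn0
    · rw [hf, zpow_zero, ← exp_zero] at hn
      simpa using exp_injective hn
    · rw [hf, zero_zpow _ hn0] at hn
      exact exp_ne_zero hn
  obtain ⟨c, hc⟩ := P.exists_val_eq_exp hπ0
  rw [hf, hc, ← exp_zsmul, exp_inj, smul_eq_mul] at hn
  rw [hc, ← exp_zero, exp_lt_exp] at hπ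
  rw [hc, exp_inj]
  have h1 : (-c) * n = 1 := by linarith
  rcases Int.eq_one_or_neg_one_of_mul_eq_one h1 with h2 | h2 <;> omega

/-- Valuation rings of places are maximal subrings. -/
theorem Place.eq_of_le {P Q : Place k F} (h : ∀ f, Q.val f ≤ 1 → P.val f ≤ 1) : P = Q := by
  have h1 : ∀ f, Q.val f = 1 → P.val f = 1 := by
    intro f hf
    have hP := h f hf.le
    have hP' := h f⁻¹ (by rw [map_inv₀, hf, inv_one])
    have hf0 : P.val f ≠ 0 := by
      rw [Valuation.ne_zero_iff]
      rintro rfl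
      simp at hf
    rw [map_inv₀, inv_le_one₀ (zero_lt_iff.2 hf0)] at hP'
    exact le_antisymm hP hP'
  obtain ⟨π, hπ0, hπ⟩ := Q.exists_eq_exp (-1)
  have h2 : ∀ (f : F) (n : ℤ), Q.val f = exp n → P.val f = P.val π ^ (-n) := by
    intro f n hn
    have hq : Q.val (f * π ^ n) = 1 := by
      rw [map_mul, map_zpow₀, hn, hπ, ← exp_zsmul, ← exp_add]
      simp
    have hp := h1 _ hq
    rw [map_mul, map_zpow₀] at hp
    rw [zpow_neg]
    exact eq_inv_of_mul_eq_one_left hp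
  have hπ1 : P.val π ≤ 1 := h π (by rw [hπ, ← exp_zero, exp_le_exp]; norm_num)
  -- Otherwise `P.val` would be `1` on all nonzero functions, against surjectivity.
  have hπ2 : P.val π ≠ 1 := by
    intro hc
    obtain ⟨f, hf0, hf⟩ := P.exists_eq_exp (-1)
    obtain ⟨n, hn⟩ := Q.exists_val_eq_exp hf0
    rw [h2 f n hn, hc, one_zpow, ← exp_zero, exp_inj] at hf
    norm_num at hf
  have hπ3 := P.val_eq_exp_neg_one (lt_of_le_of_ne hπ1 hπ2) fun f hf => by
    obtain ⟨n, hn⟩ := Q.exists_val_eq_exp hf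
    exact ⟨-n, h2 f n hn⟩
  ext f
  rcases eq_or_ne f 0 with rfl | hf
  · simp
  · obtain ⟨n, hn⟩ := Q.exists_val_eq_exp hf
    rw [h2 f n hn, hn, hπ3, ← exp_zsmul]
    simp

theorem Place.mem_ring {P : Place k F} {f : F} : f ∈ P.ring ↔ P.val f ≤ 1 := Iff.rfl

theorem Place.mem_maxIdeal {P : Place k F} {f : P.ring} :
    f ∈ P.maxIdeal ↔ P.val (f : F) < 1 := Iff.rfl

theorem Place.val_pow_lt_one {P : Place k F} {f : F} {n : ℕ} (hn : n ≠ 0) :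
    P.val (f ^ n) < 1 ↔ P.val f < 1 := by
  rw [map_pow, pow_lt_one_iff_of_nonneg zero_le hn]

/-- A place is rational if every element of its valuation ring is congruent to a constant. -/
theorem Place.degree_eq_one (P : Place k F)
    (h : ∀ f, P.val f ≤ 1 → ∃ c : k, P.val (f - algebraMap k F c) < 1) : P.degree = 1 := by
  have hne : (1 : P.ring ⧸ P.maxIdeal) ≠ 0 := by
    rw [← map_one (Ideal.Quotient.mk P.maxIdeal), Ne, Ideal.Quotient.eq_zero_iff_mem,
      Place.mem_maxIdeal]
    simp
  rw [Place.degree, finrank_eq_one_iff_of_nonzero' 1 hne]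
  intro w
  obtain ⟨f, rfl⟩ := Ideal.Quotient.mk_surjective w
  obtain ⟨c, hc⟩ := h f f.2
  refine ⟨c, ?_⟩
  rw [← Algebra.algebraMap_eq_smul_one]
  refine Eq.symm ((Ideal.Quotient.eq (I := P.maxIdeal) (x := f) (y := algebraMap k P.ring c)).2 ?_)
  exact hc

end Places

/-! ### Places attached to primes of a Dedekind domain -/

section DedekindPlaces

variable (k : Type*) {B F : Type*} [Field k] [Field F] [Algebra k F] [CommRing B]
  [IsDedekindDomain B] [Algebra B F] [IsFractionRing B F] [Algebra k B] [IsScalarTower k B F]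

/-- The place of `F` given by a maximal ideal of a Dedekind domain with fraction field `F`. -/
def Place.ofPrime (v : HeightOneSpectrum B) : Place k F where
  val := v.valuation F
  surjective := v.valuation_surjective F
  trivial_on c hc := by
    rw [IsScalarTower.algebraMap_apply k B F]
    refine (v.valuation_eq_one_iff_notMem).2 fun hmem => ?_
    have hu : IsUnit (algebraMap k B c) := (IsUnit.mk0 c hc).map _
    exact v.isPrime.ne_top (Ideal.eq_top_of_isUnit_mem _ hmem hu)

variable {k}

/-- The prime is the centre of `P` on `B`. Its localization is contained in the valuation ring of
`P`, and valuation rings of places are maximal subrings. -/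
theorem Place.exists_eq_ofPrime (P : Place k F)
    (h : ∀ b : B, P.val (algebraMap B F b) ≤ 1) :
    ∃ v : HeightOneSpectrum B, P = Place.ofPrime k v := by
  let I : Ideal B :=
    { carrier := {b | P.val (algebraMap B F b) < 1}
      add_mem' := fun {a b} ha hb => by
        simp only [Set.mem_ofPred_eq, map_add] at *
        exact P.val.map_add_lt ha hb
      zero_mem' := by simp
      smul_mem' := fun c b hb => by
        simp only [Set.mem_ofPred_eq, smul_eq_mul, map_mul] at *
        exact mul_lt_one_of_nonneg_of_lt_one_right (h c) zero_le hb }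
  have hI : ∀ b, b ∈ I ↔ P.val (algebraMap B F b) < 1 := fun b => Iff.rfl
  have hprime : I.IsPrime := by
    refine ⟨fun htop => ?_, fun {a b} hab => ?_⟩
    · have := (hI 1).1 (htop ▸ Submodule.mem_top)
      simp at this
    · rw [hI, map_mul, map_mul] at hab
      by_contra hcon
      rw [not_or, hI, hI, not_lt, not_lt] at hcon
      exact absurd (one_le_mul hcon.1 hcon.2) (not_le.2 hab)
  -- With zero centre, `P` would be trivial on `B` and hence on its fraction field.
  have hbot : I ≠ ⊥ := by
    intro hb
    have hone : ∀ b : B, b ≠ 0 → P.val (algebraMap B F b) = 1 := by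
      intro b hb0
      refine le_antisymm (h b) (not_lt.1 fun hlt => hb0 ?_)
      have := (hI b).2 hlt
      rwa [hb] at this
    obtain ⟨f, hf0, hf⟩ := P.exists_eq_exp (-1)
    obtain ⟨a, b, hb0, rfl⟩ := IsFractionRing.div_surjective (A := B) f
    have hb1 := nonZeroDivisors.ne_zero hb0
    have ha : a ≠ 0 := by
      rintro rfl
      simp at hf0
    rw [map_div₀, hone a ha, hone b hb1, div_one, ← exp_zero, exp_inj] at hf
    norm_num at hf
  refine ⟨⟨I, hprime, hbot⟩, Place.eq_of_le fun f hf => ?_⟩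
  obtain ⟨n, d, hnd⟩ := HeightOneSpectrum.exists_primeCompl_mul_eq_of_integer _ f hf
  have hd : P.val (algebraMap B F d) = 1 :=
    le_antisymm (h d) (not_lt.1 fun hlt => d.2 ((hI d).2 hlt))
  have := h n
  rwa [← hnd, map_mul, hd, mul_one] at this

theorem Place.nonempty_residueEquiv (v : HeightOneSpectrum B) :
    Nonempty ((B ⧸ v.asIdeal) ≃ₗ[k]
      ((Place.ofPrime k v : Place k F).ring ⧸ (Place.ofPrime k v : Place k F).maxIdeal)) := by
  set P : Place k F := Place.ofPrime k v with hP
  let φ : B →ₐ[k] P.ring := (IsScalarTower.toAlgHom k B F).codRestrict P.ring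
    fun b => v.valuation_le_one b
  let ψ : B →ₐ[k] (P.ring ⧸ P.maxIdeal) := (Ideal.Quotient.mkₐ k P.maxIdeal).comp φ
  have hψ : ∀ b, ψ b = Ideal.Quotient.mk P.maxIdeal (φ b) := fun b => rfl
  have hsurj : Function.Surjective ψ := by
    intro w
    obtain ⟨f, rfl⟩ := Ideal.Quotient.mk_surjective w
    obtain ⟨b, hb⟩ := v.exists_valuation_sub_lt_of_integer (x := (f : F)) f.2 1
    refine ⟨b, ?_⟩
    rw [hψ, Ideal.Quotient.eq, Place.mem_maxIdeal]
    exact hb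
  have hker : RingHom.ker ψ = v.asIdeal := by
    ext b
    rw [RingHom.mem_ker, hψ, Ideal.Quotient.eq_zero_iff_mem, Place.mem_maxIdeal]
    exact v.valuation_lt_one_iff_mem b
  exact ⟨(Ideal.quotientEquivAlgOfEq k hker.symm).toLinearEquiv.trans
    (Ideal.quotientKerAlgEquivOfSurjective hsurj).toLinearEquiv⟩

theorem Place.degree_ofPrime (v : HeightOneSpectrum B) :
    (Place.ofPrime k v : Place k F).degree = Module.finrank k (B ⧸ v.asIdeal) := by
  obtain ⟨e⟩ := Place.nonempty_residueEquiv (k := k) (F := F) v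
  exact e.finrank_eq.symm

end DedekindPlaces

/-! ### Riemann–Roch spaces: finiteness and monotonicity -/

section RiemannRochSpaces

variable {k F : Type*} [Field k] [Field F] [Algebra k F]

@[simp]
theorem Divisor.deg_zero : (0 : Divisor k F).deg = 0 := Finsupp.sum_zero_index

theorem Divisor.deg_add (D E : Divisor k F) : (D + E).deg = D.deg + E.deg :=
  Finsupp.sum_add_index' (by simp) (fun P a b => by ring)

@[simp]
theorem Divisor.deg_single (P : Place k F) (n : ℤ) :
    Divisor.deg (Finsupp.single P n) = n * P.degree :=
  Finsupp.sum_single_index (by simp)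

theorem Divisor.deg_sub (D E : Divisor k F) : (D - E).deg = D.deg - E.deg := by
  have h := Divisor.deg_add (D - E) E
  rw [sub_add_cancel] at h
  linarith

theorem Divisor.deg_sum {ι : Type*} (s : Finset ι) (D : ι → Divisor k F) :
    Divisor.deg (∑ i ∈ s, D i) = ∑ i ∈ s, (D i).deg := by
  classical
  induction s using Finset.induction_on with
  | empty => simp
  | insert a s ha ih => rw [Finset.sum_insert ha, Finset.sum_insert ha, Divisor.deg_add, ih]

theorem Divisor.mem_L {D : Divisor k F} {f : F} :
    f ∈ D.L ↔ ∀ P : Place k F, P.val f ≤ exp (D P) := Iff.rfl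

theorem Divisor.L_mono {D E : Divisor k F} (h : D ≤ E) : D.L ≤ E.L :=
  fun _ hf P => (hf P).trans (exp_le_exp.2 (h P))

/-- For an element `t` with `v_P(t) = D(P)`, the map `f ↦ (t f)(P)` on `L(D)`. -/
def Divisor.residueMap (D : Divisor k F) (P : Place k F) (t : F) (ht : P.val t = exp (-D P)) :
    D.L →ₗ[k] (P.ring ⧸ P.maxIdeal) :=
  (Ideal.Quotient.mkₐ k P.maxIdeal).toLinearMap ∘ₗ
    LinearMap.codRestrict (Subalgebra.toSubmodule P.ring)
      (LinearMap.mulLeft k t ∘ₗ D.L.subtype) (fun f => by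
        change P.val (t * (f : F)) ≤ 1
        rw [map_mul, ht]
        calc exp (-D P) * P.val (f : F) ≤ exp (-D P) * exp (D P) := by gcongr; exact f.2 P
          _ = 1 := by rw [← exp_add]; simp)

theorem Divisor.mem_ker_residueMap (D : Divisor k F) (P : Place k F) (t : F)
    (ht : P.val t = exp (-D P)) (f : D.L) :
    f ∈ LinearMap.ker (D.residueMap P t ht) ↔
      (f : F) ∈ (D - Finsupp.single P 1 : Divisor k F).L := by
  classical
  have h1 : f ∈ LinearMap.ker (D.residueMap P t ht) ↔ P.val (t * (f : F)) < 1 := by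
    rw [LinearMap.mem_ker]
    exact Ideal.Quotient.eq_zero_iff_mem
  have h2 : P.val (t * (f : F)) < 1 ↔ P.val (f : F) ≤ exp (D P - 1) := by
    rcases eq_or_ne (f : F) 0 with hf | hf
    · simp [hf]
    · obtain ⟨n, hn⟩ := P.exists_val_eq_exp hf
      rw [map_mul, ht, hn, ← exp_add, ← exp_zero, exp_lt_exp, exp_le_exp]
      omega
  rw [h1, h2, Divisor.mem_L]
  refine ⟨fun h Q => ?_, fun h => by simpa using h P⟩
  rcases eq_or_ne Q P with rfl | hQ
  · simpa using h
  · simpa [Finsupp.single_apply, hQ.symm] using f.2 Q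

/-- Thus `L(D) / L(D - P)` embeds in the residue field of `P`, which drives both the finiteness of
`L(D)` and the growth estimate for `ℓ`. -/
theorem Divisor.exists_residueMap (D : Divisor k F) (P : Place k F) :
    ∃ ρ : D.L →ₗ[k] (P.ring ⧸ P.maxIdeal), ∀ f : D.L,
      f ∈ LinearMap.ker ρ ↔ (f : F) ∈ (D - Finsupp.single P 1 : Divisor k F).L := by
  obtain ⟨t, -, ht⟩ := P.exists_eq_exp (-D P)
  exact ⟨_, D.mem_ker_residueMap P t ht⟩

theorem Divisor.finite_L_of_sub_single (D : Divisor k F) (P : Place k F)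
    [Module.Finite k (P.ring ⧸ P.maxIdeal)]
    [Module.Finite k (D - Finsupp.single P 1 : Divisor k F).L] : Module.Finite k D.L := by
  obtain ⟨ρ, hρ⟩ := D.exists_residueMap P
  have h1 : Module.Finite k (LinearMap.ker ρ) := by
    refine Module.Finite.of_injective (M := LinearMap.ker ρ)
      (N := (D - Finsupp.single P 1 : Divisor k F).L)
      (LinearMap.codRestrict _ (D.L.subtype ∘ₗ (LinearMap.ker ρ).subtype)
        fun f => (hρ f).1 f.2) ?_
    intro f g hfg
    have h := congrArg Subtype.val hfg
    exact Subtype.ext (Subtype.ext h)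
  have h2 : Module.Finite k (D.L ⧸ LinearMap.ker ρ) :=
    Module.Finite.equiv ρ.quotKerEquivRange.symm
  exact Module.Finite.of_submodule_quotient (LinearMap.ker ρ)

theorem Divisor.ell_le_ell_sub_single (D : Divisor k F) (P : Place k F)
    [Module.Finite k (P.ring ⧸ P.maxIdeal)] [Module.Finite k D.L] :
    D.ell ≤ (D - Finsupp.single P 1 : Divisor k F).ell + P.degree := by
  obtain ⟨ρ, hρ⟩ := D.exists_residueMap P
  have hle : (D - Finsupp.single P 1 : Divisor k F).L ≤ D.L := Divisor.L_mono fun Q => by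
    classical
    rw [Finsupp.sub_apply, Finsupp.single_apply]
    split_ifs <;> simp
  have : Module.Finite k (D - Finsupp.single P 1 : Divisor k F).L :=
    Submodule.finiteDimensional_of_le hle
  have h1 : Module.finrank k (LinearMap.ker ρ) ≤ (D - Finsupp.single P 1 : Divisor k F).ell := by
    refine LinearMap.finrank_le_finrank_of_injective
      (f := LinearMap.codRestrict _ (D.L.subtype ∘ₗ (LinearMap.ker ρ).subtype)
        fun f => (hρ f).1 f.2) ?_
    intro f g hfg
    have h := congrArg Subtype.val hfg
    exact Subtype.ext (Subtype.ext h)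
  have h2 := LinearMap.finrank_range_add_finrank_ker ρ
  have h3 : Module.finrank k (LinearMap.range ρ) ≤ P.degree := Submodule.finrank_le _
  rw [Divisor.ell, ← h2]
  omega

theorem Divisor.finite_L_add
    (hres : ∀ P : Place k F, Module.Finite k (P.ring ⧸ P.maxIdeal))
    (E : Divisor k F) :
    ∀ D : Divisor k F, Module.Finite k D.L → Module.Finite k (D + E : Divisor k F).L := by
  induction E using Finsupp.induction_linear with
  | zero => intro D hD; rwa [add_zero]
  | add E₁ E₂ h₁ h₂ => intro D hD; rw [← add_assoc]; exact h₂ _ (h₁ _ hD)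
  | single P a =>
    intro D hD
    have hnat : ∀ n : ℕ, Module.Finite k (D + Finsupp.single P (n : ℤ) : Divisor k F).L := by
      intro n
      induction n with
      | zero => rwa [Nat.cast_zero, Finsupp.single_zero, add_zero]
      | succ n ih =>
        have := hres P
        have h : (D + Finsupp.single P ((n + 1 : ℕ) : ℤ) : Divisor k F) - Finsupp.single P 1 =
            D + Finsupp.single P (n : ℤ) := by
          rw [add_sub_assoc, ← Finsupp.single_sub]
          push_cast
          rw [add_sub_cancel_right]
        have : Module.Finite k ((D + Finsupp.single P ((n + 1 : ℕ) : ℤ) : Divisor k F) -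
            Finsupp.single P 1 : Divisor k F).L := by rwa [h]
        exact Divisor.finite_L_of_sub_single _ P
    -- A negative coefficient only shrinks the space, so the positive part of `a` suffices.
    have := hnat a.toNat
    refine Submodule.finiteDimensional_of_le
      (Divisor.L_mono (E := D + Finsupp.single P (a.toNat : ℤ)) ?_)
    gcongr
    exact Int.self_le_toNat a

theorem Divisor.finite_L
    (hres : ∀ P : Place k F, Module.Finite k (P.ring ⧸ P.maxIdeal))
    (h0 : Module.Finite k (0 : Divisor k F).L) (D : Divisor k F) :
    Module.Finite k D.L := by
  have h := Divisor.finite_L_add hres D 0 h0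
  rwa [zero_add] at h

theorem Divisor.deg_sub_ell_add_single
    (hres : ∀ P : Place k F, Module.Finite k (P.ring ⧸ P.maxIdeal))
    (hL : ∀ D : Divisor k F, Module.Finite k D.L)
    (D : Divisor k F) (P : Place k F) (n : ℕ) :
    D.deg - D.ell ≤ (D + Finsupp.single P (n : ℤ) : Divisor k F).deg -
      (D + Finsupp.single P (n : ℤ) : Divisor k F).ell := by
  induction n with
  | zero => simp
  | succ n ih =>
    refine ih.trans ?_
    have := hres P
    have := hL (D + Finsupp.single P ((n + 1 : ℕ) : ℤ))
    have h : (D + Finsupp.single P ((n + 1 : ℕ) : ℤ) : Divisor k F) - Finsupp.single P 1 =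
        D + Finsupp.single P (n : ℤ) := by
      rw [add_sub_assoc, ← Finsupp.single_sub]
      push_cast
      rw [add_sub_cancel_right]
    have h1 := Divisor.ell_le_ell_sub_single (D + Finsupp.single P ((n + 1 : ℕ) : ℤ)) P
    rw [h] at h1
    rw [Divisor.deg_add, Divisor.deg_add, Divisor.deg_single, Divisor.deg_single]
    push_cast
    have h2 : ((D + Finsupp.single P ((n + 1 : ℕ) : ℤ) : Divisor k F).ell : ℤ) ≤
      (D + Finsupp.single P (n : ℤ) : Divisor k F).ell + P.degree := by exact_mod_cast h1
    push_cast at h2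
    linarith

/-- `deg D - ℓ(D)` is monotone in `D`. -/
theorem Divisor.deg_sub_ell_mono
    (hres : ∀ P : Place k F, Module.Finite k (P.ring ⧸ P.maxIdeal))
    (hL : ∀ D : Divisor k F, Module.Finite k D.L)
    {D D' : Divisor k F} (h : D ≤ D') : D.deg - D.ell ≤ D'.deg - D'.ell := by
  classical
  have key : ∀ E : Divisor k F, 0 ≤ E → ∀ D : Divisor k F,
      D.deg - D.ell ≤ (D + E).deg - (D + E : Divisor k F).ell := by
    intro E
    induction E using Finsupp.induction with
    | zero => simp
    | single_add P a E ha hb ih =>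
      intro hE D
      have haE : E P = 0 := Finsupp.notMem_support_iff.1 ha
      have ha0 : 0 ≤ a := by simpa [haE] using hE P
      have hE0 : 0 ≤ E := fun Q => by
        rcases eq_or_ne P Q with rfl | hQ
        · simp [haE]
        · simpa [Finsupp.single_apply, hQ] using hE Q
      lift a to ℕ using ha0
      rw [← add_assoc]
      exact (Divisor.deg_sub_ell_add_single hres hL D P a).trans (ih hE0 _)
  have := key (D' - D) (sub_nonneg.2 h) D
  rwa [add_sub_cancel] at this

/-- Multiplication by a function with divisor `D - D'`. -/
theorem Divisor.ell_le_ell_of_val_eq {D D' : Divisor k F} [Module.Finite k D'.L] {z : F}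
    (hz0 : z ≠ 0)
    (hz : ∀ P : Place k F, P.val z = exp (D' P - D P)) : D.ell ≤ D'.ell := by
  refine LinearMap.finrank_le_finrank_of_injective
    (f := LinearMap.codRestrict D'.L (LinearMap.mulLeft k z ∘ₗ D.L.subtype) fun f P => ?_) ?_
  · change P.val (z * (f : F)) ≤ _
    rw [map_mul, hz]
    calc exp (D' P - D P) * P.val (f : F) ≤ exp (D' P - D P) * exp (D P) := by gcongr; exact f.2 P
      _ = exp (D' P) := by rw [← exp_add]; simp
  · intro f g hfg
    have h : z * (f : F) = z * g := congrArg Subtype.val hfg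
    exact Subtype.ext (mul_left_cancel₀ hz0 h)

end RiemannRochSpaces

/-! ### Extensions of Dedekind domains and degrees of zero divisors -/

theorem finite_quotient_of_liesOver {k A B : Type*} [Field k] [CommRing A] [CommRing B]
    [Algebra k A] [Algebra k B] [Algebra A B] [IsScalarTower k A B] [Module.Finite A B]
    (p : Ideal A) (q : Ideal B) [q.LiesOver p] [Module.Finite k (A ⧸ p)] :
    Module.Finite k (B ⧸ q) :=
  have : Module.Finite (A ⧸ p) (B ⧸ q) := inferInstance
  Module.Finite.trans (A ⧸ p) (B ⧸ q)

section DedekindExtensions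

variable {k B F : Type*} [Field k] [Field F] [Algebra k F] [CommRing B]
  [IsDedekindDomain B] [Algebra B F] [IsFractionRing B F] [Algebra k B] [IsScalarTower k B F]

theorem Place.ofPrime_injective :
    Function.Injective (Place.ofPrime k : HeightOneSpectrum B → Place k F) := by
  intro v w h
  ext b
  rw [← v.valuation_lt_one_iff_mem (K := F), ← w.valuation_lt_one_iff_mem (K := F)]
  have : v.valuation F = w.valuation F := congrArg Place.val h
  rw [this]

variable {A : Type*} (K : Type*) [CommRing A] [IsDedekindDomain A] [Algebra k A] [Algebra A B]
  [IsScalarTower k A B] [Module.Finite A B] [Module.IsTorsionFree A B]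
  [Field K] [Algebra A K] [IsFractionRing A K] [Algebra A F] [Algebra K F]
  [IsScalarTower A K F] [IsScalarTower A B F]

/-- The zero divisor of a prime element `π` of `A`, for an extension `B / A` of Dedekind domains:
its degree is given by the fundamental identity. -/
theorem exists_zeroDivisor (v : HeightOneSpectrum A) (π : A) (hπ : v.asIdeal = Ideal.span {π}) :
    ∃ Z : Divisor k F,
      (∀ w : HeightOneSpectrum B,
        w.valuation F (algebraMap A F π) = exp (-Z (Place.ofPrime k w))) ∧
      (∀ w : HeightOneSpectrum B, 0 ≤ Z (Place.ofPrime k w)) ∧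
      (∀ Q : Place k F, (∀ w : HeightOneSpectrum B, Q ≠ Place.ofPrime k w) → Z Q = 0) ∧
      Z.deg = Module.finrank K F * Module.finrank k (A ⧸ v.asIdeal) := by
  classical
  have hπ0 : π ≠ 0 := by
    rintro rfl
    exact v.ne_bot (by rw [hπ]; simp)
  have hmax : v.asIdeal.IsMaximal := v.isMaximal
  have hmem : ∀ I : Ideal B, I ∈ IsDedekindDomain.primesOverFinset v.asIdeal B ↔
      I ∈ v.asIdeal.primesOver B :=
    fun I => IsDedekindDomain.mem_primesOverFinset_iff v.ne_bot B
  have hbot : ∀ I : Ideal B, I ∈ IsDedekindDomain.primesOverFinset v.asIdeal B → I ≠ ⊥ := by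
    intro I hI
    have := ((hmem I).1 hI).2
    exact Ideal.ne_bot_of_liesOver_of_ne_bot v.ne_bot I
  let w : IsDedekindDomain.primesOverFinset v.asIdeal B → HeightOneSpectrum B := fun I =>
    ⟨I.1, ((hmem I.1).1 I.2).1, hbot I.1 I.2⟩
  let Z : Divisor k F := ∑ I : IsDedekindDomain.primesOverFinset v.asIdeal B,
    Finsupp.single (Place.ofPrime k (w I)) (v.asIdeal.ramificationIdx' I.1 : ℤ)
  have hZ : ∀ Q, Z Q = ∑ I : IsDedekindDomain.primesOverFinset v.asIdeal B,
      if Place.ofPrime k (w I) = Q then (v.asIdeal.ramificationIdx' I.1 : ℤ) else 0 := by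
    intro Q
    simp only [Z, Finsupp.finsetSum_apply, Finsupp.single_apply]
  have hval : ∀ u : HeightOneSpectrum B,
      u.valuation F (algebraMap A F π) = exp (-Z (Place.ofPrime k u)) := by
    intro u
    rw [hZ, IsScalarTower.algebraMap_apply A B F, HeightOneSpectrum.valuation_of_algebraMap]
    by_cases hu : u.asIdeal ∈ IsDedekindDomain.primesOverFinset v.asIdeal B
    · have : u.asIdeal.LiesOver v.asIdeal := ((hmem _).1 hu).2
      rw [Finset.sum_eq_single (⟨u.asIdeal, hu⟩ : IsDedekindDomain.primesOverFinset v.asIdeal B),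
        if_pos rfl,
        ← HeightOneSpectrum.intValuation_liesOver v u,
        v.intValuation_singleton hπ0 hπ, ← exp_nsmul, exp_inj]
      · simp
      · intro I _ hI
        rw [if_neg]
        intro h
        exact hI (Subtype.ext (congrArg HeightOneSpectrum.asIdeal (Place.ofPrime_injective h)))
      · simp
    -- A prime `u` containing `π` would contract to an ideal containing the maximal ideal `(π)`,
    -- hence equal to it; so away from the primes over `v` the element `π` is a unit.
    · rw [Finset.sum_eq_zero, neg_zero, exp_zero, HeightOneSpectrum.intValuation_eq_one_iff]
      · intro hmem'
        refine hu ((hmem _).2 ⟨u.isPrime, ⟨?_⟩⟩)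
        refine hmax.eq_of_le (Ideal.IsPrime.under A u.asIdeal).ne_top ?_
        rw [hπ, Ideal.span_singleton_le_iff_mem]
        exact hmem'
      · intro I _
        rw [if_neg]
        intro h
        exact hu ((Place.ofPrime_injective h) ▸ I.2)
  refine ⟨Z, hval, ?_, ?_, ?_⟩
  · intro u
    rw [hZ]
    exact Finset.sum_nonneg fun I _ => by split_ifs <;> positivity
  · intro Q hQ
    rw [hZ]
    exact Finset.sum_eq_zero fun I _ => if_neg fun h => hQ _ h.symm
  · rw [← Ideal.sum_ramification_inertia B K F v.ne_bot, Divisor.deg_sum]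
    simp only [Divisor.deg_single, Place.degree_ofPrime]
    push_cast
    rw [Finset.sum_mul, ← Finset.sum_coe_sort (IsDedekindDomain.primesOverFinset v.asIdeal B)]
    refine Finset.sum_congr rfl fun I _ => ?_
    have : I.1.LiesOver v.asIdeal := ((hmem _).1 I.2).2
    let := Ideal.Quotient.field v.asIdeal
    rw [Ideal.inertiaDeg'_algebraMap, mul_assoc]
    congr 1
    rw [mul_comm]
    exact_mod_cast (Module.finrank_mul_finrank k (A ⧸ v.asIdeal) (B ⧸ I.1)).symm

end DedekindExtensions

/-! ### The integral closure of `k[z]` in `F` and the places finite for `z` -/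

section AffineRing

open IntermediateField Polynomial
open scoped algebraAdjoinAdjoin

variable {k F : Type*} [Field k] [Field F] [Algebra k F] {z : F}

theorem isPrincipalIdealRing_adjoin (hz : Transcendental k z) :
    IsPrincipalIdealRing (Algebra.adjoin k {z}) :=
  IsPrincipalIdealRing.of_surjective (Polynomial.algEquivOfTranscendental k z hz).toRingEquiv
    (Polynomial.algEquivOfTranscendental k z hz).surjective

theorem Place.val_le_one_of_isIntegral {P : Place k F} (hP : P.val z ≤ 1) {h : F}
    (hh : IsIntegral (Algebra.adjoin k {z}) h) : P.val h ≤ 1 := by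
  have hle : Algebra.adjoin k {z} ≤ P.ring :=
    Algebra.adjoin_le (by simpa [Place.mem_ring] using hP)
  have h1 : IsIntegral P.val.integer h := by
    obtain ⟨p, hp, hp0⟩ := hh
    let φ : Algebra.adjoin k {z} →+* P.val.integer :=
      (algebraMap (Algebra.adjoin k {z}) F).codRestrict P.val.integer fun a => hle a.2
    refine ⟨p.map φ, hp.map φ, ?_⟩
    rw [eval₂_map]
    exact hp0
  exact (Valuation.integer.integers P.val).mem_of_integral h1

theorem finrank_quotient_adjoin (hz : Transcendental k z) {p : k[X]} (hp : p ≠ 0)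
    (I : Ideal (Algebra.adjoin k {z}))
    (hI : I = Ideal.span {Polynomial.algEquivOfTranscendental k z hz p}) :
    Module.Finite k (Algebra.adjoin k {z} ⧸ I) ∧
      Module.finrank k (Algebra.adjoin k {z} ⧸ I) = p.natDegree := by
  let e := Ideal.quotientEquivAlg (R₁ := k) (Ideal.span {p}) I
    (Polynomial.algEquivOfTranscendental k z hz) (by
      rw [hI, Ideal.map_span, Set.image_singleton]
      rfl)
  have : Module.Finite k (k[X] ⧸ Ideal.span {p}) := (AdjoinRoot.powerBasis hp).finite
  exact ⟨Module.Finite.equiv e.toLinearEquiv, by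
    rw [← e.toLinearEquiv.finrank_eq, finrank_quotient_span_eq_natDegree]⟩

variable [FiniteDimensional k⟮z⟯ F]

theorem isFractionRing_integralClosure :
    IsFractionRing (integralClosure (Algebra.adjoin k {z}) F) F :=
  integralClosure.isFractionRing_of_finite_extension k⟮z⟯ F

variable [Algebra.IsSeparable k⟮z⟯ F]

theorem isDedekindDomain_integralClosure (hz : Transcendental k z) :
    IsDedekindDomain (integralClosure (Algebra.adjoin k {z}) F) :=
  have := isPrincipalIdealRing_adjoin hz
  integralClosure.isDedekindDomain (Algebra.adjoin k {z}) k⟮z⟯ F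

theorem finite_integralClosure (hz : Transcendental k z) :
    Module.Finite (Algebra.adjoin k {z}) (integralClosure (Algebra.adjoin k {z}) F) :=
  have := isPrincipalIdealRing_adjoin hz
  IsIntegralClosure.finite (Algebra.adjoin k {z}) k⟮z⟯ F _

theorem exists_place_of_ideal (hz : Transcendental k z)
    (I : Ideal (integralClosure (Algebra.adjoin k {z}) F)) (htop : I ≠ ⊤) (hbot : I ≠ ⊥) :
    ∃ P : Place k F, P.val z ≤ 1 ∧ ∀ b ∈ I, P.val (b : F) < 1 := by
  have := isDedekindDomain_integralClosure (F := F) hz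
  have := isFractionRing_integralClosure (k := k) (F := F) (z := z)
  obtain ⟨M, hM, hIM⟩ := Ideal.exists_le_maximal I htop
  let v : HeightOneSpectrum (integralClosure (Algebra.adjoin k {z}) F) :=
    ⟨M, hM.isPrime, fun h => hbot (le_bot_iff.1 (h ▸ hIM))⟩
  refine ⟨Place.ofPrime k v, ?_, fun b hb => ?_⟩
  · exact v.valuation_le_one (K := F) (algebraMap (Algebra.adjoin k {z}) _
      ⟨z, Algebra.self_mem_adjoin_singleton k z⟩)
  · exact (v.valuation_lt_one_iff_mem (K := F) b).2 (hIM hb)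

/-- A Dedekind domain is the intersection of its localizations, and all primes of the integral
closure give places with `v(z) ≥ 0`. -/
theorem isIntegral_of_val_le_one (hz : Transcendental k z) {h : F}
    (hh : ∀ P : Place k F, P.val z ≤ 1 → P.val h ≤ 1) : IsIntegral (Algebra.adjoin k {z}) h := by
  have := isDedekindDomain_integralClosure (F := F) hz
  have := isFractionRing_integralClosure (k := k) (F := F) (z := z)
  obtain ⟨b, rfl⟩ := HeightOneSpectrum.mem_integers_of_valuation_le_one
    (R := integralClosure (Algebra.adjoin k {z}) F) F h fun v => by
      refine hh (Place.ofPrime k v) ?_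
      exact v.valuation_le_one (K := F) (algebraMap (Algebra.adjoin k {z}) _
        ⟨z, Algebra.self_mem_adjoin_singleton k z⟩)
  exact b.2

/-- A place which is finite with respect to `z` has a finite residue field, and is a zero of some
polynomial `p(z)`, whose zero divisor has degree `[F : k(z)] deg p`. -/
theorem exists_zeroDivisor_polynomial (hz : Transcendental k z) (P : Place k F)
    (hP : P.val z ≤ 1) : Module.Finite k (P.ring ⧸ P.maxIdeal) ∧
    ∃ (p : k[X]) (Z : Divisor k F), 1 ≤ Z P ∧ (∀ Q, 0 ≤ Z Q) ∧
      (∀ Q : Place k F, Q.val z ≤ 1 → Q.val (aeval z p) = exp (-Z Q)) ∧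
      (∀ Q : Place k F, 1 < Q.val z → Z Q = 0) ∧
      p ≠ 0 ∧ Z.deg = Module.finrank k⟮z⟯ F * p.natDegree := by
  have := isPrincipalIdealRing_adjoin hz
  have := isDedekindDomain_integralClosure (F := F) hz
  have := isFractionRing_integralClosure (k := k) (F := F) (z := z)
  have := finite_integralClosure (F := F) hz
  have hQ : ∀ Q : Place k F, Q.val z ≤ 1 → ∃ w :
      HeightOneSpectrum (integralClosure (Algebra.adjoin k {z}) F), Q = Place.ofPrime k w :=
    fun Q h => Q.exists_eq_ofPrime fun b => Place.val_le_one_of_isIntegral h b.2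
  have hQ' : ∀ w : HeightOneSpectrum (integralClosure (Algebra.adjoin k {z}) F),
      (Place.ofPrime k w : Place k F).val z ≤ 1 := fun w =>
    w.valuation_le_one (K := F) (algebraMap (Algebra.adjoin k {z}) _
      ⟨z, Algebra.self_mem_adjoin_singleton k z⟩)
  obtain ⟨w, rfl⟩ := hQ P hP
  -- The place is a prime `w` of the integral closure; its contraction to `k[z]` is principal, and
  -- `p` is the polynomial of a generator.
  let v : HeightOneSpectrum (Algebra.adjoin k {z}) :=
    ⟨w.asIdeal.under _, inferInstance, Ideal.IsIntegral.comap_ne_bot _ w.ne_bot⟩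
  obtain ⟨π, hπ⟩ := (IsPrincipalIdealRing.principal v.asIdeal).principal
  obtain ⟨p, rfl⟩ := (Polynomial.algEquivOfTranscendental k z hz).surjective π
  have hp0 : p ≠ 0 := by
    rintro rfl
    exact v.ne_bot (by rw [hπ]; simp)
  have hcoe : ((Polynomial.algEquivOfTranscendental k z hz p : Algebra.adjoin k {z}) : F) =
      aeval z p := by simp
  obtain ⟨hfin, hrank⟩ := finrank_quotient_adjoin hz hp0 v.asIdeal hπ
  have : w.asIdeal.LiesOver v.asIdeal := ⟨rfl⟩
  have hfin' := finite_quotient_of_liesOver (k := k) v.asIdeal w.asIdeal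
  refine ⟨?_, ?_⟩
  · obtain ⟨e⟩ := Place.nonempty_residueEquiv (k := k) (F := F) w
    exact Module.Finite.equiv e
  obtain ⟨Z, hZ1, hZ2, hZ3, hZ4⟩ := exists_zeroDivisor (k := k) (F := F)
    (B := integralClosure (Algebra.adjoin k {z}) F) k⟮z⟯ v _ hπ
  refine ⟨p, Z, ?_, ?_, ?_, ?_, hp0, ?_⟩
  · have h1 := hZ1 w
    have h2 : w.valuation F (algebraMap (Algebra.adjoin k {z}) F
        (Polynomial.algEquivOfTranscendental k z hz p)) < 1 := by
      rw [IsScalarTower.algebraMap_apply _ (integralClosure (Algebra.adjoin k {z}) F) F]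
      rw [w.valuation_lt_one_iff_mem]
      have : Polynomial.algEquivOfTranscendental k z hz p ∈ v.asIdeal := by
        rw [hπ]; exact Ideal.mem_span_singleton_self _
      exact this
    rw [h1, ← exp_zero, exp_lt_exp] at h2
    omega
  · intro Q
    by_cases h : Q.val z ≤ 1
    · obtain ⟨u, rfl⟩ := hQ Q h
      exact hZ2 u
    · rw [hZ3 Q fun u hu => h (hu ▸ hQ' u)]
  · intro Q h
    obtain ⟨u, rfl⟩ := hQ Q h
    rw [← hZ1 u, ← hcoe]
    rfl
  · intro Q h
    exact hZ3 Q fun u hu => absurd (hu ▸ hQ' u) (not_le.2 h)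
  · rw [hZ4, hrank]

end AffineRing

/-! ### Leading terms common to a set of places -/

section LeadingTerms

open Polynomial

variable {k F : Type*} [Field k] [Field F] [Algebra k F] {S : Set (Place k F)} {π : F}

/-- At all places of `S`, the function `h` has the leading term `c π ^ n` for a constant
`c ≠ 0`. -/
def HasLeading (S : Set (Place k F)) (π h : F) (n : ℤ) : Prop :=
  ∃ c : k, c ≠ 0 ∧ ∀ P ∈ S, P.val (h * π ^ (-n) - algebraMap k F c) < 1

theorem Place.val_eq_one_of_sub_lt {P : Place k F} {u : F} {c : k} (hc : c ≠ 0)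
    (h : P.val (u - algebraMap k F c) < 1) : P.val u = 1 := by
  have h1 := P.trivial_on c hc
  rw [← h1] at h
  have := Valuation.map_add_eq_of_lt_left P.val h
  rwa [add_sub_cancel, h1] at this

theorem HasLeading.const {c : k} (hc : c ≠ 0) : HasLeading S π (algebraMap k F c) 0 :=
  ⟨c, hc, fun P _ => by simp⟩

theorem HasLeading.val_eq {h : F} {n : ℤ} (hh : HasLeading S π h n) (hπ : π ≠ 0) {P : Place k F}
    (hP : P ∈ S) : P.val h = P.val π ^ n := by
  obtain ⟨c, hc, hh⟩ := hh
  have h1 := Place.val_eq_one_of_sub_lt hc (hh P hP)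
  rw [map_mul, map_zpow₀, zpow_neg] at h1
  have h2 : P.val π ^ n ≠ 0 := zpow_ne_zero _ ((Valuation.ne_zero_iff _).2 hπ)
  exact (mul_inv_eq_one₀ h2).1 h1

theorem HasLeading.mul {h₁ h₂ : F} {n₁ n₂ : ℤ} (H₁ : HasLeading S π h₁ n₁)
    (H₂ : HasLeading S π h₂ n₂) (hπ : π ≠ 0) : HasLeading S π (h₁ * h₂) (n₁ + n₂) := by
  obtain ⟨c₁, hc₁, H₁⟩ := H₁
  obtain ⟨c₂, hc₂, H₂⟩ := H₂
  refine ⟨c₁ * c₂, mul_ne_zero hc₁ hc₂, fun P hP => ?_⟩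
  have e : h₁ * h₂ * π ^ (-(n₁ + n₂)) - algebraMap k F (c₁ * c₂) =
      (h₁ * π ^ (-n₁) - algebraMap k F c₁) * (h₂ * π ^ (-n₂)) +
      algebraMap k F c₁ * (h₂ * π ^ (-n₂) - algebraMap k F c₂) := by
    rw [neg_add, zpow_add₀ hπ, map_mul]
    ring
  rw [e]
  refine P.val.map_add_lt ?_ ?_
  · rw [map_mul, Place.val_eq_one_of_sub_lt hc₂ (H₂ P hP), mul_one]
    exact H₁ P hP
  · rw [map_mul, P.trivial_on c₁ hc₁, one_mul]
    exact H₂ P hP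

theorem HasLeading.inv {h : F} {n : ℤ} (H : HasLeading S π h n) :
    HasLeading S π h⁻¹ (-n) := by
  obtain ⟨c, hc, H⟩ := H
  refine ⟨c⁻¹, inv_ne_zero hc, fun P hP => ?_⟩
  have h1 := Place.val_eq_one_of_sub_lt hc (H P hP)
  have hu : h * π ^ (-n) ≠ 0 := by
    intro h0
    rw [h0, map_zero] at h1
    exact zero_ne_one h1
  have hc' : algebraMap k F c ≠ 0 := by simpa using hc
  have e : h⁻¹ * π ^ (- -n) - algebraMap k F c⁻¹ =
      -((h * π ^ (-n) - algebraMap k F c) * (h * π ^ (-n))⁻¹ * (algebraMap k F c)⁻¹) := by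
    have e1 : h⁻¹ * π ^ (- -n) = (h * π ^ (-n))⁻¹ := by
      rw [mul_inv, zpow_neg _ (-n)]
    rw [e1, map_inv₀]
    generalize h * π ^ (-n) = u at *
    field_simp
    ring
  rw [e, Valuation.map_neg, map_mul, map_mul, map_inv₀, map_inv₀, h1, P.trivial_on c hc]
  simpa using H P hP

theorem HasLeading.pow {h : F} {n : ℤ} (H : HasLeading S π h n) (hπ : π ≠ 0) (j : ℕ) :
    HasLeading S π (h ^ j) (j * n) := by
  induction j with
  | zero => simpa using HasLeading.const (S := S) (π := π) (one_ne_zero (α := k))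
  | succ j ih =>
    rw [pow_succ]
    convert ih.mul H hπ using 1
    push_cast
    ring

theorem HasLeading.zpow {h : F} {n : ℤ} (H : HasLeading S π h n) (hπ : π ≠ 0) (j : ℤ) :
    HasLeading S π (h ^ j) (j * n) := by
  cases j with
  | ofNat j => simpa using H.pow hπ j
  | negSucc j =>
    rw [zpow_negSucc, Int.negSucc_eq, neg_mul]
    exact_mod_cast (H.pow hπ (j + 1)).inv

theorem HasLeading.add_lt {h₁ h₂ : F} {n₁ n₂ : ℤ} (H₁ : HasLeading S π h₁ n₁)
    (H₂ : HasLeading S π h₂ n₂) (hπ : π ≠ 0) (hS : ∀ P ∈ S, P.val π < 1) (hn : n₁ < n₂) :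
    HasLeading S π (h₁ + h₂) n₁ := by
  have hval := fun P hP => H₂.val_eq hπ (P := P) hP
  obtain ⟨c₁, hc₁, H₁⟩ := H₁
  refine ⟨c₁, hc₁, fun P hP => ?_⟩
  have e : (h₁ + h₂) * π ^ (-n₁) - algebraMap k F c₁ =
      (h₁ * π ^ (-n₁) - algebraMap k F c₁) + h₂ * π ^ (-n₁) := by ring
  rw [e]
  refine P.val.map_add_lt (H₁ P hP) ?_
  have hv : P.val π ≠ 0 := (Valuation.ne_zero_iff _).2 hπ
  rw [map_mul, map_zpow₀, hval P hP, ← zpow_add₀ hv]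
  obtain ⟨d, hd⟩ := P.exists_val_eq_exp hπ
  have h1 := hS P hP
  rw [hd, ← exp_zero, exp_lt_exp] at h1
  rw [hd, ← exp_zsmul, ← exp_zero, exp_lt_exp, smul_eq_mul]
  nlinarith

/-- With pairwise distinct exponents, the term of least exponent dominates. -/
theorem HasLeading.sum {ι : Type*} {s : Finset ι} (hs : s.Nonempty) {h : ι → F} {n : ι → ℤ}
    (hπ : π ≠ 0) (hS : ∀ P ∈ S, P.val π < 1) (H : ∀ i ∈ s, HasLeading S π (h i) (n i))
    (hn : Set.InjOn n s) : ∃ i ∈ s, HasLeading S π (∑ i ∈ s, h i) (n i) := by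
  induction hs using Finset.Nonempty.cons_induction with
  | singleton a => exact ⟨a, by simp, by simpa using H a (by simp)⟩
  | cons a s ha hs ih =>
    obtain ⟨i, hi, Hi⟩ := ih (fun i hi => H i (Finset.mem_cons_of_mem hi))
      (hn.mono fun i hi => Finset.mem_cons_of_mem hi)
    have Ha := H a (Finset.mem_cons_self a s)
    rw [Finset.sum_cons]
    have hne : n a ≠ n i := fun h => ha
      ((hn (Finset.mem_cons_self a s) (Finset.mem_cons_of_mem hi) h) ▸ hi)
    rcases lt_or_gt_of_ne hne with hlt | hlt
    · exact ⟨a, Finset.mem_cons_self a s, Ha.add_lt Hi hπ hS hlt⟩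
    · refine ⟨i, Finset.mem_cons_of_mem hi, ?_⟩
      rw [add_comm]
      exact Hi.add_lt Ha hπ hS hlt

theorem HasLeading.aeval {z : F} {d : ℤ} (hz : HasLeading S π z d) (hd : d ≠ 0) (hπ : π ≠ 0)
    (hS : ∀ P ∈ S, P.val π < 1) {p : k[X]} (hp : p ≠ 0) :
    ∃ j : ℤ, HasLeading S π (Polynomial.aeval z p) (j * d) := by
  obtain ⟨j, -, hj⟩ := HasLeading.sum (S := S) (π := π) (s := p.support)
    (h := fun j => algebraMap k F (p.coeff j) * z ^ j) (n := fun j => (j : ℤ) * d)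
    (Polynomial.nonempty_support_iff.2 hp) hπ hS (fun j hj => by
      have := (HasLeading.const (S := S) (π := π) (Polynomial.mem_support_iff.1 hj)).mul
        (hz.pow hπ j) hπ
      rwa [zero_add] at this) (fun i _ j _ hij => by
      exact_mod_cast mul_right_cancel₀ hd hij)
  refine ⟨j, ?_⟩
  rwa [aeval_def, eval₂_eq_sum, Polynomial.sum_def]

/-- If all functions have leading terms at the places of `S`, then `S` consists of at most one
rational place, at which `π` is a uniformizer. -/
theorem Place.eq_of_hasLeading (hπ : π ≠ 0) (hS : ∀ P ∈ S, P.val π < 1)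
    (H : ∀ h : F, h ≠ 0 → ∃ n, HasLeading S π h n) :
    S.Subsingleton ∧ ∀ P ∈ S, P.val π = exp (-1) ∧
      ∀ f, P.val f ≤ 1 → ∃ c : k, P.val (f - algebraMap k F c) < 1 := by
  have hunif : ∀ P ∈ S, P.val π = exp (-1) := fun P hP =>
    P.val_eq_exp_neg_one (hS P hP) fun f hf =>
      let ⟨n, hn⟩ := H f hf
      ⟨n, hn.val_eq hπ hP⟩
  refine ⟨fun P hP Q hQ => ?_, fun P hP => ⟨hunif P hP, fun f hf => ?_⟩⟩
  · ext f
    rcases eq_or_ne f 0 with rfl | hf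
    · simp
    · obtain ⟨n, hn⟩ := H f hf
      rw [hn.val_eq hπ hP, hn.val_eq hπ hQ, hunif P hP, hunif Q hQ]
  · rcases eq_or_ne f 0 with rfl | hf0
    · exact ⟨0, by simp⟩
    obtain ⟨n, hn⟩ := H f hf0
    have hval := hn.val_eq hπ hP
    rw [hunif P hP, ← exp_zsmul] at hval
    rw [hval, ← exp_zero, exp_le_exp, smul_eq_mul] at hf
    rcases (show n = 0 ∨ 0 < n by omega) with rfl | hn0
    · obtain ⟨c, -, hc⟩ := hn
      exact ⟨c, by simpa using hc P hP⟩
    · refine ⟨0, ?_⟩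
      rw [map_zero, sub_zero, hval, ← exp_zero, exp_lt_exp, smul_eq_mul]
      omega

end LeadingTerms

/-! ### The extension `F / k(y)` generated by `x` -/

section KummerField

open IntermediateField Polynomial
open scoped algebraAdjoinAdjoin

/-- The function field `F = k(x, y)` of the curve `∏ i, (y - α i) = x ^ m`. -/
structure IsKummer {k F : Type*} [Field k] [Field F] [Algebra k F] {r : ℕ} (m : ℕ)
    (α : Fin r → k) (x y : F) : Prop where
  pos : 0 < r
  cast_ne_zero : (m : k) ≠ 0
  coprime : Nat.Coprime r m
  injective : Function.Injective α
  transcendental : Transcendental k y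
  eq : ∏ i, (y - algebraMap k F (α i)) = x ^ m
  adjoin_eq_top : IntermediateField.adjoin k {x, y} = ⊤

/-- The polynomial `∏ i, (X - α i)`. -/
def rootPoly {k : Type*} [Field k] {r : ℕ} (α : Fin r → k) : k[X] := ∏ i, (X - C (α i))

theorem rootPoly_monic {k : Type*} [Field k] {r : ℕ} (α : Fin r → k) : (rootPoly α).Monic :=
  monic_prod_of_monic _ _ fun i _ => monic_X_sub_C (α i)

theorem rootPoly_eval {k : Type*} [Field k] {r : ℕ} (α : Fin r → k) (b : k) :
    (rootPoly α).eval b = ∏ i, (b - α i) := by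
  simp [rootPoly, eval_prod]

variable {k F : Type*} [Field k] [Field F] [Algebra k F] {r m : ℕ} {α : Fin r → k} {x y : F}

theorem adjoin_inv_eq : k⟮y⁻¹⟯ = k⟮y⟯ := by
  refine le_antisymm ?_ ?_
  · rw [adjoin_simple_le_iff]
    exact inv_mem (mem_adjoin_simple_self k y)
  · rw [adjoin_simple_le_iff]
    have := inv_mem (mem_adjoin_simple_self k y⁻¹)
    rwa [inv_inv] at this

namespace IsKummer

theorem m_ne_zero (H : IsKummer m α x y) : m ≠ 0 := by
  rintro rfl
  exact H.cast_ne_zero (by simp)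

theorem aeval_rootPoly (H : IsKummer m α x y) : aeval y (rootPoly α) = x ^ m := by
  rw [← H.eq, rootPoly, map_prod]
  simp

theorem aeval_ne_zero (H : IsKummer m α x y) {p : k[X]} (hp : p ≠ 0) : aeval y p ≠ 0 := fun h =>
  hp ((transcendental_iff.1 H.transcendental) p h)

theorem x_ne_zero (H : IsKummer m α x y) : x ≠ 0 := by
  rintro rfl
  have h := H.aeval_rootPoly
  rw [zero_pow H.m_ne_zero] at h
  exact H.aeval_ne_zero (rootPoly_monic α).ne_zero h

theorem y_ne_zero (H : IsKummer m α x y) : y ≠ 0 := by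
  simpa using H.aeval_ne_zero (p := X) X_ne_zero

theorem y_sub_ne_zero (H : IsKummer m α x y) (b : k) : y - algebraMap k F b ≠ 0 := by
  simpa using H.aeval_ne_zero (X_sub_C_ne_zero b)

theorem adjoin_x_eq_top (H : IsKummer m α x y) : IntermediateField.adjoin k⟮y⟯ {x} = ⊤ := by
  rw [← restrictScalars_eq_top_iff (K := k), adjoin_simple_adjoin_simple, ← H.adjoin_eq_top,
    Set.pair_comm]

theorem aeval_X_pow_sub_C (H : IsKummer m α x y) :
    aeval x (X ^ m - C (aeval (AdjoinSimple.gen k y) (rootPoly α)) : k⟮y⟯[X]) = 0 := by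
  have h : algebraMap k⟮y⟯ F (aeval (AdjoinSimple.gen k y) (rootPoly α)) = x ^ m := by
    rw [← H.aeval_rootPoly, ← aeval_algebraMap_apply, AdjoinSimple.algebraMap_gen]
  simp [h]

theorem isIntegral_x (H : IsKummer m α x y) : IsIntegral k⟮y⟯ x :=
  ⟨_, monic_X_pow_sub_C _ H.m_ne_zero, H.aeval_X_pow_sub_C⟩

theorem finiteDimensional (H : IsKummer m α x y) : FiniteDimensional k⟮y⟯ F := by
  have := adjoin.finiteDimensional H.isIntegral_x
  rw [H.adjoin_x_eq_top] at this
  exact Module.Finite.equiv (topEquiv (F := k⟮y⟯) (E := F)).toLinearEquiv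

/-- `X^m - c` is separable because `c ≠ 0` and `m` is nonzero in `k`. -/
theorem isSeparable_x (H : IsKummer m α x y) : IsSeparable k⟮y⟯ x := by
  refine Polynomial.Separable.of_dvd (separable_X_pow_sub_C
    (aeval (AdjoinSimple.gen k y) (rootPoly α)) ?_ ?_) (minpoly.dvd _ _ H.aeval_X_pow_sub_C)
  · rw [← map_natCast (algebraMap k k⟮y⟯)]
    exact (_root_.map_ne_zero _).2 H.cast_ne_zero
  · intro h
    have h' := congrArg (algebraMap k⟮y⟯ F) h
    rw [← aeval_algebraMap_apply, AdjoinSimple.algebraMap_gen, map_zero] at h'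
    exact H.aeval_ne_zero (rootPoly_monic α).ne_zero h'

theorem isSeparable (H : IsKummer m α x y) : Algebra.IsSeparable k⟮y⟯ F := by
  have := (isSeparable_adjoin_simple_iff_isSeparable k⟮y⟯ F).2 H.isSeparable_x
  rw [H.adjoin_x_eq_top] at this
  exact Algebra.IsSeparable.of_algHom _ _ (topEquiv (F := k⟮y⟯) (E := F)).symm.toAlgHom

theorem exists_sum_eq (H : IsKummer m α x y) (h : F) :
    ∃ c : Fin m → k⟮y⟯, h = ∑ i, (c i : F) * x ^ (i : ℕ) := by
  have hx : h ∈ IntermediateField.adjoin k⟮y⟯ {x} := by rw [H.adjoin_x_eq_top]; trivial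
  rw [← mem_toSubalgebra, adjoin_simple_toSubalgebra_of_isAlgebraic H.isIntegral_x.isAlgebraic,
    Algebra.adjoin_singleton_eq_range_aeval] at hx
  obtain ⟨p, rfl⟩ := hx
  have hmon := monic_X_pow_sub_C (aeval (AdjoinSimple.gen k y) (rootPoly α)) H.m_ne_zero
  have h1 := aeval_modByMonic_eq_self_of_root (p := p) H.aeval_X_pow_sub_C
  have hdeg : (p %ₘ (X ^ m - C (aeval (AdjoinSimple.gen k y) (rootPoly α)))).natDegree < m := by
    have := natDegree_modByMonic_lt p hmon (by
      intro h1
      have := congrArg natDegree h1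
      rw [natDegree_X_pow_sub_C, natDegree_one] at this
      exact H.m_ne_zero this)
    rwa [natDegree_X_pow_sub_C] at this
  refine ⟨fun i => (p %ₘ (X ^ m - C (aeval (AdjoinSimple.gen k y) (rootPoly α)))).coeff i, ?_⟩
  change aeval x p = _
  rw [← h1, aeval_eq_sum_range' hdeg, Finset.sum_range]
  rfl

end IsKummer

end KummerField

/-! ### The place at infinity -/

section Infinity

open IntermediateField Polynomial
open scoped algebraAdjoinAdjoin

variable {k F : Type*} [Field k] [Field F] [Algebra k F] {r m : ℕ} {α : Fin r → k} {x y : F}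

/-- A pole of `y` is a prime containing `y⁻¹` in the integral closure of `k[y⁻¹]`. One exists unless
`y⁻¹` is a unit there; then `y` would be integral over the integrally closed ring `k[y⁻¹]`, hence a
polynomial in `y⁻¹`, against transcendence. -/
theorem exists_place_one_lt_val [FiniteDimensional k⟮y⟯ F] [Algebra.IsSeparable k⟮y⟯ F]
    (hy : Transcendental k y) : ∃ P : Place k F, 1 < P.val y := by
  have hy' : Transcendental k y⁻¹ := fun h => hy (by simpa using h.inv)
  have hy0 : y ≠ 0 := fun h => hy (h ▸ isAlgebraic_zero)
  have : FiniteDimensional k⟮y⁻¹⟯ F := by rwa [adjoin_inv_eq]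
  have : Algebra.IsSeparable k⟮y⁻¹⟯ F := by rwa [adjoin_inv_eq]
  have := isPrincipalIdealRing_adjoin hy'
  let w : integralClosure (Algebra.adjoin k {y⁻¹}) F :=
    algebraMap (Algebra.adjoin k {y⁻¹}) _ ⟨y⁻¹, Algebra.self_mem_adjoin_singleton k y⁻¹⟩
  have hw : (w : F) = y⁻¹ := rfl
  have hw0 : w ≠ 0 := fun h => inv_ne_zero hy0 (by rw [← hw, h]; rfl)
  have hunit : ¬ IsUnit w := by
    rintro ⟨u, hu⟩
    obtain ⟨b, hb⟩ : ∃ b : integralClosure (Algebra.adjoin k {y⁻¹}) F, b * w = 1 :=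
      ⟨((u⁻¹ : _ˣ) : _), by rw [← hu]; simp⟩
    have hb' : (b : F) * y⁻¹ = 1 := congrArg Subtype.val hb
    have hint : IsIntegral (Algebra.adjoin k {y⁻¹}) y := by
      have h := b.2
      rw [(mul_inv_eq_one₀ hy0).1 hb'] at h
      exact h
    have hmem : y ∈ k⟮y⁻¹⟯ := by
      rw [adjoin_inv_eq]
      exact mem_adjoin_simple_self k y
    have hint' : IsIntegral (Algebra.adjoin k {y⁻¹}) (⟨y, hmem⟩ : k⟮y⁻¹⟯) :=
      (isIntegral_algebraMap_iff (algebraMap k⟮y⁻¹⟯ F).injective).1 hint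
    obtain ⟨a, ha⟩ := IsIntegrallyClosed.isIntegral_iff.1 hint'
    have ha' : (a : F) = y := congrArg Subtype.val ha
    have hamem := a.2
    rw [ha', Algebra.adjoin_singleton_eq_range_aeval] at hamem
    obtain ⟨p, hp⟩ := hamem
    have hp' : aeval y⁻¹ p = y := hp
    have hzero : X * p - 1 = 0 := transcendental_iff.1 hy' _ (by
      rw [map_sub, map_mul, aeval_X, hp', map_one, inv_mul_cancel₀ hy0, sub_self])
    have := congrArg (eval 0) hzero
    simp at this
  obtain ⟨P, -, hP⟩ := exists_place_of_ideal hy' (Ideal.span {w})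
    (fun h => hunit (Ideal.span_singleton_eq_top.1 h))
    (fun h => hw0 (Ideal.span_singleton_eq_bot.1 h))
  refine ⟨P, ?_⟩
  have := hP w (Ideal.mem_span_singleton_self w)
  rw [hw, map_inv₀] at this
  exact (inv_lt_one₀ (zero_lt_iff.2 ((Valuation.ne_zero_iff _).2 hy0))).1 this

theorem Place.val_sub_algebraMap_of_one_lt {P : Place k F} {f : F} (hf : 1 < P.val f) (c : k) :
    P.val (f - algebraMap k F c) = P.val f :=
  Valuation.map_sub_eq_of_lt_left _ ((P.val_algebraMap_le c).trans_lt hf)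

theorem HasLeading.prod {S : Set (Place k F)} {π : F} (hπ : π ≠ 0) {ι : Type*} (s : Finset ι)
    {h : ι → F} (hh : ∀ i ∈ s, HasLeading S π (h i) 0) : HasLeading S π (∏ i ∈ s, h i) 0 := by
  classical
  induction s using Finset.induction_on with
  | empty => simpa using HasLeading.const (S := S) (π := π) (one_ne_zero (α := k))
  | insert a s ha ih =>
    rw [Finset.prod_insert ha]
    simpa using (hh a (Finset.mem_insert_self a s)).mul
      (ih fun i hi => hh i (Finset.mem_insert_of_mem hi)) hπ

theorem HasLeading.self_zpow {S : Set (Place k F)} {π : F} (hπ : π ≠ 0) (n : ℤ) :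
    HasLeading S π (π ^ n) n :=
  ⟨1, one_ne_zero, fun P _ => by rw [← zpow_add₀ hπ]; simp⟩

/-- At a place where `v(x)` is prime to `m` and `m` divides `v(c)` for all `c ∈ k(y)`, the orders
of the monomials `c i * x ^ i` with `i < m` are pairwise distinct. -/
theorem monomial_exponent_injective {e : ℤ} {m : ℕ} (he : IsCoprime e (m : ℤ)) (j : Fin m → ℤ) :
    Function.Injective fun i : Fin m => j i * m + (i : ℕ) * e := by
  intro a b hab
  have h1 : (m : ℤ) ∣ ((a : ℕ) - (b : ℕ) : ℤ) * e := ⟨j b - j a, by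
    simp only at hab
    linarith⟩
  have h2 := (he.symm).dvd_of_dvd_mul_right h1
  have ha := a.2
  have hb := b.2
  have h3 : ((a : ℕ) - (b : ℕ) : ℤ) = 0 := by
    refine Int.eq_zero_of_abs_lt_dvd h2 ?_
    rw [abs_lt]
    omega
  exact Fin.ext (by omega)

namespace IsKummer

theorem val_x_pow (H : IsKummer m α x y) (P : Place k F) :
    P.val x ^ m = ∏ i, P.val (y - algebraMap k F (α i)) := by
  rw [← map_pow, ← H.eq, map_prod]

theorem val_x_le_one (H : IsKummer m α x y) {P : Place k F} (hP : P.val y ≤ 1) :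
    P.val x ≤ 1 := by
  rw [← pow_le_one_iff_of_nonneg zero_le H.m_ne_zero, H.val_x_pow]
  exact Finset.prod_le_one' fun i _ => P.val.map_sub_le hP (P.val_algebraMap_le _)

theorem val_x_pow_eq (H : IsKummer m α x y) {P : Place k F} (hP : 1 < P.val y) :
    P.val x ^ m = P.val y ^ r := by
  rw [H.val_x_pow, Finset.prod_congr rfl fun i _ => Place.val_sub_algebraMap_of_one_lt hP (α i)]
  simp

theorem isAtInfinity_iff (H : IsKummer m α x y) {P : Place k F} :
    P.IsAtInfinity x y ↔ 1 < P.val y := by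
  refine ⟨fun h => ?_, fun h => Or.inr h⟩
  by_contra hy
  exact (h.resolve_right hy).not_ge (H.val_x_le_one (not_lt.1 hy))

theorem exists_isAtInfinity (H : IsKummer m α x y) : ∃ P : Place k F, P.IsAtInfinity x y := by
  have := H.finiteDimensional
  have := H.isSeparable
  obtain ⟨P, hP⟩ := exists_place_one_lt_val H.transcendental
  exact ⟨P, Or.inr hP⟩

/-- If the leading exponent of `y` is a nonzero multiple of `m` and that of `x` is prime to `m`,
then all functions have leading terms. -/
theorem hasLeading_of_coprime (H : IsKummer m α x y) {S : Set (Place k F)} {π : F} (hπ : π ≠ 0)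
    (hS : ∀ P ∈ S, P.val π < 1) {d e : ℤ} (hd : d ≠ 0) (hmd : (m : ℤ) ∣ d)
    (hy : HasLeading S π y d) (hx : HasLeading S π x e) (he : IsCoprime e (m : ℤ)) (h : F)
    (hh : h ≠ 0) : ∃ n, HasLeading S π h n := by
  classical
  obtain ⟨c, rfl⟩ := H.exists_sum_eq h
  have hc : ∀ i, ∃ j : ℤ, (c i ≠ 0 → HasLeading S π (c i : F) (j * m)) := by
    intro i
    by_cases hi : c i = 0
    · exact ⟨0, fun h => absurd hi h⟩
    obtain ⟨d', rfl⟩ := hmd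
    obtain ⟨p, q, hpq⟩ := (mem_adjoin_simple_iff k _).1 (c i).2
    have hci : (c i : F) ≠ 0 := by simpa using hi
    have hp : p ≠ 0 := by
      rintro rfl
      rw [map_zero, zero_div] at hpq
      exact hci hpq
    have hq : q ≠ 0 := by
      rintro rfl
      rw [map_zero, div_zero] at hpq
      exact hci hpq
    obtain ⟨j₁, h₁⟩ := hy.aeval hd hπ hS hp
    obtain ⟨j₂, h₂⟩ := hy.aeval hd hπ hS hq
    refine ⟨j₁ * d' - j₂ * d', fun _ => ?_⟩
    rw [hpq, div_eq_mul_inv]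
    convert h₁.mul h₂.inv hπ using 1
    ring
  choose j hj using hc
  have hs : ∑ i, (c i : F) * x ^ (i : ℕ) =
      ∑ i ∈ Finset.univ.filter (fun i => c i ≠ 0), (c i : F) * x ^ (i : ℕ) := by
    rw [Finset.sum_filter]
    refine Finset.sum_congr rfl fun i _ => ?_
    split_ifs with hi
    · rfl
    · rw [not_not.1 hi]
      simp
  have hne : (Finset.univ.filter (fun i => c i ≠ 0)).Nonempty := by
    rw [Finset.nonempty_iff_ne_empty]
    intro h0
    rw [hs, h0, Finset.sum_empty] at hh
    exact hh rfl
  rw [hs]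
  obtain ⟨i, -, hi⟩ := HasLeading.sum hne hπ hS (n := fun i : Fin m => j i * m + (i : ℕ) * e)
    (fun i hi => (hj i (Finset.mem_filter.1 hi).2).mul (hx.pow hπ i) hπ)
    ((monomial_exponent_injective he j).injOn)
  exact ⟨_, hi⟩

/-- There is only one place at infinity; it is rational, and `x` and `y` have poles of order
`r` and `m` there. -/
theorem place_at_infinity (H : IsKummer m α x y) :
    {P : Place k F | P.IsAtInfinity x y}.Subsingleton ∧ ∀ P : Place k F, P.IsAtInfinity x y →
      P.val x = exp (r : ℤ) ∧ P.val y = exp (m : ℤ) ∧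
      ∀ f, P.val f ≤ 1 → ∃ c : k, P.val (f - algebraMap k F c) < 1 := by
  have hx0 := H.x_ne_zero
  have hy0 := H.y_ne_zero
  have hm0 := H.m_ne_zero
  obtain ⟨u, v, huv⟩ := Nat.isCoprime_iff_coprime.2 H.coprime
  set S : Set (Place k F) := {P : Place k F | P.IsAtInfinity x y} with hSdef
  -- With `u r + v m = 1`, this has order `1` once `x` and `y` have orders `-r` and `-m`.
  set π : F := x ^ (-u) * y ^ (-v) with hπdef
  have hπ : π ≠ 0 := mul_ne_zero (zpow_ne_zero _ hx0) (zpow_ne_zero _ hy0)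
  have hval : ∀ P ∈ S, ∃ t : ℤ, 0 < t ∧ P.val x = exp (r * t) ∧ P.val y = exp (m * t) := by
    intro P hP
    have hy1 : 1 < P.val y := H.isAtInfinity_iff.1 hP
    have hrel := H.val_x_pow_eq hy1
    obtain ⟨a, ha⟩ := P.exists_val_eq_exp hx0
    obtain ⟨b, hb⟩ := P.exists_val_eq_exp hy0
    rw [ha, hb, ← exp_nsmul, ← exp_nsmul, exp_inj, nsmul_eq_mul, nsmul_eq_mul] at hrel
    rw [hb, ← exp_zero, exp_lt_exp] at hy1
    have ht : b = m * (u * a + v * b) := by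
      linear_combination (-b) * huv - u * hrel
    have ht' : a = r * (u * a + v * b) := by
      linear_combination (-a) * huv + v * hrel
    refine ⟨u * a + v * b, ?_, by rw [ha, ← ht'], by rw [hb, ← ht]⟩
    have hmpos : (0 : ℤ) < m := by exact_mod_cast Nat.pos_of_ne_zero hm0
    by_contra hcon
    nlinarith
  have hvalπ : ∀ P ∈ S, P.val π < 1 := by
    intro P hP
    obtain ⟨t, ht, hx, hy⟩ := hval P hP
    rw [hπdef, map_mul, map_zpow₀, map_zpow₀, hx, hy, ← exp_zsmul, ← exp_zsmul, ← exp_add,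
      ← exp_zero, exp_lt_exp, smul_eq_mul, smul_eq_mul]
    have : -u * (r * t) + -v * (m * t) = -t := by linear_combination (-t) * huv
    rw [this]
    omega
  -- `w = ∏ (1 - α_i / y)` is congruent to `1` at every pole of `y`; below, `y = w^(-u) π^(-m)` and
  -- `x = w^v π^(-r)`, which gives both functions leading terms.
  set w : F := x ^ m / y ^ r with hwdef
  have hw : HasLeading S π w 0 := by
    have e : w = ∏ i, (1 - algebraMap k F (α i) / y) := by
      rw [hwdef, ← H.eq, div_eq_iff (pow_ne_zero _ hy0)]
      have : y ^ r = ∏ i : Fin r, y := by simp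
      rw [this, ← Finset.prod_mul_distrib]
      refine Finset.prod_congr rfl fun i _ => ?_
      field_simp
    rw [e]
    refine HasLeading.prod hπ _ fun i _ => ⟨1, one_ne_zero, fun P hP => ?_⟩
    have hy1 : 1 < P.val y := H.isAtInfinity_iff.1 hP
    have e2 : (1 - algebraMap k F (α i) / y) * π ^ (-0 : ℤ) - algebraMap k F 1 =
        -(algebraMap k F (α i) / y) := by simp
    rw [e2, Valuation.map_neg, map_div₀]
    exact (div_lt_one₀ (zero_lt_one.trans hy1)).2 ((P.val_algebraMap_le _).trans_lt hy1)
  have hw' : w = x ^ (m : ℤ) * y ^ (-r : ℤ) := by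
    rw [hwdef, zpow_neg, zpow_natCast, zpow_natCast, div_eq_mul_inv]
  have hyπ : HasLeading S π y (-m) := by
    have e : y = w ^ (-u) * π ^ (-m : ℤ) := by
      rw [hw', hπdef, mul_zpow, mul_zpow, ← zpow_mul, ← zpow_mul, ← zpow_mul, ← zpow_mul]
      rw [mul_mul_mul_comm, ← zpow_add₀ hx0, ← zpow_add₀ hy0]
      have e1 : (m : ℤ) * -u + -u * -m = 0 := by ring
      have e2 : (-r : ℤ) * -u + -v * -m = 1 := by linear_combination huv
      rw [e1, e2]
      simp
    rw [e]
    simpa using (hw.zpow hπ (-u)).mul (HasLeading.self_zpow hπ (-m)) hπ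
  have hxπ : HasLeading S π x (-r) := by
    have e : x = w ^ v * π ^ (-r : ℤ) := by
      rw [hw', hπdef, mul_zpow, mul_zpow, ← zpow_mul, ← zpow_mul, ← zpow_mul, ← zpow_mul]
      rw [mul_mul_mul_comm, ← zpow_add₀ hx0, ← zpow_add₀ hy0]
      have e1 : (m : ℤ) * v + -u * -r = 1 := by linear_combination huv
      have e2 : (-r : ℤ) * v + -v * -r = 0 := by ring
      rw [e1, e2]
      simp
    rw [e]
    simpa using (hw.zpow hπ v).mul (HasLeading.self_zpow hπ (-r)) hπ
  have hcop : IsCoprime (-(r : ℤ)) (m : ℤ) := (Nat.isCoprime_iff_coprime.2 H.coprime).neg_left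
  obtain ⟨h1, h2⟩ := Place.eq_of_hasLeading hπ hvalπ fun h hh =>
    H.hasLeading_of_coprime hπ hvalπ (d := -m) (by simpa using hm0) (by simp) hyπ hxπ hcop h hh
  refine ⟨h1, fun P hP => ⟨?_, ?_, (h2 P hP).2⟩⟩
  · rw [hxπ.val_eq hπ hP, (h2 P hP).1, ← exp_zsmul]
    simp
  · rw [hyπ.val_eq hπ hP, (h2 P hP).1, ← exp_zsmul]
    simp

end IsKummer

end Infinity

/-! ### The affine points: uniqueness and rationality -/

section Points

open IntermediateField Polynomial

variable {k F : Type*} [Field k] [Field F] [Algebra k F] {r m : ℕ} {α : Fin r → k} {x y : F}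

theorem Place.val_aeval_le_one {P : Place k F} {f : F} (hf : P.val f ≤ 1) (p : k[X]) :
    P.val (aeval f p) ≤ 1 := by
  have hle : Algebra.adjoin k {f} ≤ P.ring :=
    Algebra.adjoin_le (by simpa [Place.mem_ring] using hf)
  refine hle ?_
  rw [Algebra.adjoin_singleton_eq_range_aeval]
  exact ⟨p, rfl⟩

theorem Place.val_le_one_of_sub_lt {P : Place k F} {f : F} {a : k}
    (hf : P.val (f - algebraMap k F a) < 1) : P.val f ≤ 1 := by
  have := P.val.map_add_le hf.le (P.val_algebraMap_le a)
  rwa [sub_add_cancel] at this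

theorem Place.val_aeval_sub_lt {P : Place k F} {f : F} {a : k}
    (hf : P.val (f - algebraMap k F a) < 1) (p : k[X]) :
    P.val (aeval f p - algebraMap k F (p.eval a)) < 1 := by
  obtain ⟨q, hq⟩ := X_sub_C_dvd_sub_C_eval (p := p) (a := a)
  have h := congrArg (aeval f) hq
  simp only [map_sub, map_mul, aeval_C, aeval_X] at h
  rw [h, map_mul]
  exact mul_lt_one_of_lt_of_le hf (Place.val_aeval_le_one (Place.val_le_one_of_sub_lt hf) q)

theorem Place.val_algebraMap_lt_one_iff (P : Place k F) {c : k} :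
    P.val (algebraMap k F c) < 1 ↔ c = 0 := by
  refine ⟨fun h => ?_, fun h => by simp [h]⟩
  by_contra hc
  exact h.ne (P.trivial_on c hc)

theorem Place.eq_of_sub_lt {P : Place k F} {f : F} {a b : k}
    (ha : P.val (f - algebraMap k F a) < 1) (hb : P.val (f - algebraMap k F b) < 1) : a = b := by
  have h := P.val.map_sub_lt hb ha
  rw [sub_sub_sub_cancel_left, ← map_sub, P.val_algebraMap_lt_one_iff, sub_eq_zero] at h
  exact h

namespace IsKummer

theorem eq_of_isAt (H : IsKummer m α x y) {P : Place k F} {a b : k} (hP : P.IsAt x y a b) :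
    ∏ i, (b - α i) = a ^ m := by
  have h1 := Place.val_aeval_sub_lt hP.1 (X ^ m)
  have h2 := Place.val_aeval_sub_lt hP.2 (rootPoly α)
  rw [H.aeval_rootPoly, rootPoly_eval] at h2
  simp only [map_pow, aeval_X, eval_pow, eval_X] at h1
  rw [← map_pow] at h1
  exact Place.eq_of_sub_lt h2 h1

/-- Leading terms at a point with principal maximal ideal. -/
theorem hasLeading_of_principal (H : IsKummer m α x y) {a b : k} {π s s₁ s₂ : F} (hπ : π ≠ 0)
    (hs : s ∈ Algebra.adjoin k {x, y}) (hs₁ : s₁ ∈ Algebra.adjoin k {x, y})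
    (hs₂ : s₂ ∈ Algebra.adjoin k {x, y}) (hx : (x - algebraMap k F a) * s = π * s₁)
    (hy : (y - algebraMap k F b) * s = π * s₂)
    (hval : ∀ P : Place k F, P.IsAt x y a b → P.val s = 1 ∧ P.val π < 1) (h : F) (hh : h ≠ 0) :
    ∃ n, HasLeading {P : Place k F | P.IsAt x y a b} π h n := by
  set S := {P : Place k F | P.IsAt x y a b} with hS
  rcases S.eq_empty_or_nonempty with hemp | ⟨P₀, hP₀⟩
  · exact ⟨0, 1, one_ne_zero, fun P hP => by rw [hemp] at hP; exact hP.elim⟩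
  have hle : ∀ P ∈ S, ∀ h ∈ Algebra.adjoin k {x, y}, P.val h ≤ 1 := by
    intro P hP h hh
    have hle : Algebra.adjoin k {x, y} ≤ P.ring := Algebra.adjoin_le (by
      rintro z (rfl | rfl)
      · exact Place.val_le_one_of_sub_lt hP.1
      · exact Place.val_le_one_of_sub_lt hP.2)
    exact hle hh
  -- Since `s` is a unit at the places of `S`, this says that every polynomial in `x, y` is a
  -- constant plus a multiple of `π`. It passes from `x` and `y` to sums and products.
  have step : ∀ h ∈ Algebra.adjoin k {x, y}, ∃ c : k, ∃ h' ∈ Algebra.adjoin k {x, y},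
      (h - algebraMap k F c) * s = π * h' := by
    intro h hh
    induction hh using Algebra.adjoin_induction with
    | mem z hz =>
      rcases hz with rfl | rfl
      · exact ⟨a, s₁, hs₁, hx⟩
      · exact ⟨b, s₂, hs₂, hy⟩
    | algebraMap c => exact ⟨c, 0, zero_mem _, by simp⟩
    | add u v hu hv ihu ihv =>
      obtain ⟨c, u', hu', hcu⟩ := ihu
      obtain ⟨d, v', hv', hdv⟩ := ihv
      exact ⟨c + d, u' + v', add_mem hu' hv', by rw [map_add]; linear_combination hcu + hdv⟩
    | mul u v hu hv ihu ihv =>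
      obtain ⟨c, u', hu', hcu⟩ := ihu
      obtain ⟨d, v', hv', hdv⟩ := ihv
      refine ⟨c * d, u' * v + algebraMap k F c * v', add_mem (mul_mem hu' hv)
        (mul_mem (Subalgebra.algebraMap_mem _ c) hv'), ?_⟩
      rw [map_mul]
      linear_combination v * hcu + algebraMap k F c * hdv
  have hlt : ∀ P ∈ S, ∀ (h h' : F) (c : k), h' ∈ Algebra.adjoin k {x, y} →
      (h - algebraMap k F c) * s = π * h' → P.val (h - algebraMap k F c) < 1 := by
    intro P hP h h' c hh' e
    have h1 := congrArg P.val e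
    rw [map_mul, map_mul, (hval P hP).1, mul_one] at h1
    rw [h1]
    exact mul_lt_one_of_lt_of_le (hval P hP).2 (hle P hP h' hh')
  have hsL : HasLeading S π s 0 := by
    obtain ⟨c, h', hh', e⟩ := step s hs
    refine ⟨c, ?_, fun P hP => by simpa using hlt P hP s h' c hh' e⟩
    rintro rfl
    have := hlt P₀ hP₀ s h' 0 hh' e
    rw [map_zero, sub_zero] at this
    exact this.ne (hval P₀ hP₀).1
  have hs0 : s ≠ 0 := by
    rintro rfl
    simpa using (hval P₀ hP₀).1
  -- Induction on the order at the fixed place `P₀`: if the constant is zero, divide by `π`, which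
  -- lowers the order; if not, it is the leading coefficient at all places of `S`.
  have main : ∀ N : ℕ, ∀ h ∈ Algebra.adjoin k {x, y}, P₀.val h = exp (-N : ℤ) →
      ∃ n, HasLeading S π h n := by
    intro N
    induction N using Nat.strong_induction_on with
    | _ N ih =>
      intro h hh hN
      obtain ⟨c, h', hh', e⟩ := step h hh
      by_cases hc : c = 0
      · subst hc
        rw [map_zero, sub_zero] at e
        have hv := congrArg P₀.val e
        have hh'0 : h' ≠ 0 := by
          rintro rfl
          rw [map_mul, hN, (hval P₀ hP₀).1, mul_zero, map_zero, mul_one] at hv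
          exact exp_ne_zero hv
        obtain ⟨d, hd⟩ := P₀.exists_val_eq_exp hπ
        obtain ⟨n', hn'⟩ := P₀.exists_val_eq_exp hh'0
        have hd0 := (hval P₀ hP₀).2
        rw [hd, ← exp_zero, exp_lt_exp] at hd0
        have hn'0 := hle P₀ hP₀ h' hh'
        rw [hn', ← exp_zero, exp_le_exp] at hn'0
        rw [map_mul, map_mul, hN, (hval P₀ hP₀).1, mul_one, hd, hn', ← exp_add, exp_inj] at hv
        obtain ⟨n, hn⟩ := ih (-n').toNat (by omega) h' hh' (by
          rw [hn', exp_inj]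
          omega)
        refine ⟨1 + n + -0, ?_⟩
        have e2 : h = π ^ (1 : ℤ) * h' * s⁻¹ := by
          rw [zpow_one, ← e]
          field_simp
        rw [e2]
        exact ((HasLeading.self_zpow hπ 1).mul hn hπ).mul hsL.inv hπ
      · exact ⟨0, c, hc, fun P hP => by simpa using hlt P hP h h' c hh' e⟩
  have main' : ∀ h ∈ Algebra.adjoin k {x, y}, h ≠ 0 → ∃ n, HasLeading S π h n := by
    intro h hh hh0
    obtain ⟨n, hn⟩ := P₀.exists_val_eq_exp hh0
    have hn0 := hle P₀ hP₀ h hh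
    rw [hn, ← exp_zero, exp_le_exp] at hn0
    exact main (-n).toNat h hh (by rw [hn, exp_inj]; omega)
  have hmem : h ∈ IntermediateField.adjoin k {x, y} := by rw [H.adjoin_eq_top]; trivial
  obtain ⟨u, hu, v, hv, rfl⟩ := mem_adjoin_iff_div.1 hmem
  have hu0 : u ≠ 0 := fun h0 => hh (by rw [h0, zero_div])
  have hv0 : v ≠ 0 := fun h0 => hh (by rw [h0, div_zero])
  obtain ⟨n₁, h₁⟩ := main' u hu hu0
  obtain ⟨n₂, h₂⟩ := main' v hv hv0
  rw [div_eq_mul_inv]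
  exact ⟨_, h₁.mul h₂.inv hπ⟩

theorem exists_eq_of_isAt_zero (H : IsKummer m α x y) {b : k} (h : ∏ i, (b - α i) = 0 ^ m) :
    ∃ t, b = α t := by
  rw [zero_pow H.m_ne_zero, Finset.prod_eq_zero_iff] at h
  obtain ⟨t, -, ht⟩ := h
  exact ⟨t, sub_eq_zero.1 ht⟩

theorem val_prod_erase (H : IsKummer m α x y) {P : Place k F} {t : Fin r}
    (hP : P.val (y - algebraMap k F (α t)) < 1) :
    P.val (∏ i ∈ Finset.univ.erase t, (y - algebraMap k F (α i))) = 1 := by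
  rw [map_prod]
  refine Finset.prod_eq_one fun i hi => ?_
  have hne : α t - α i ≠ 0 := fun h =>
    (Finset.mem_erase.1 hi).1 (H.injective (sub_eq_zero.1 h).symm)
  refine Place.val_eq_one_of_sub_lt hne ?_
  rw [(algebraMap k F).map_sub, sub_sub_sub_cancel_right]
  exact hP

theorem mul_prod_erase (H : IsKummer m α x y) (t : Fin r) :
    (y - algebraMap k F (α t)) * ∏ i ∈ Finset.univ.erase t, (y - algebraMap k F (α i)) =
      x ^ m := by
  rw [← H.eq]
  exact Finset.mul_prod_erase _ (fun i => y - algebraMap k F (α i)) (Finset.mem_univ t)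

/-- There is at most one place above an affine point; it is rational, and `x` is a uniformizer
if the point lies on `x = 0`. -/
theorem place_at_point (H : IsKummer m α x y) {a b : k} (hab : ∏ i, (b - α i) = a ^ m) :
    {P : Place k F | P.IsAt x y a b}.Subsingleton ∧ ∀ P : Place k F, P.IsAt x y a b →
      (a = 0 → P.val x = exp (-1)) ∧
      ∀ f, P.val f ≤ 1 → ∃ c : k, P.val (f - algebraMap k F c) < 1 := by
  have hxm : x ∈ Algebra.adjoin k {x, y} := Algebra.subset_adjoin (by simp)
  have hym : y ∈ Algebra.adjoin k {x, y} := Algebra.subset_adjoin (by simp)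
  have hysub : ∀ c : k, y - algebraMap k F c ∈ Algebra.adjoin k {x, y} := fun c =>
    sub_mem hym (Subalgebra.algebraMap_mem _ c)
  by_cases ha : a = 0
  · subst ha
    obtain ⟨t, rfl⟩ := H.exists_eq_of_isAt_zero hab
    have hval : ∀ P : Place k F, P.IsAt x y 0 (α t) →
        P.val (∏ i ∈ Finset.univ.erase t, (y - algebraMap k F (α i))) = 1 ∧ P.val x < 1 :=
      fun P hP => ⟨H.val_prod_erase hP.2, by simpa using hP.1⟩
    -- Here `π = x` and `s = ∏_{i ≠ t} (y - α_i)`, a unit at the point, with `(y - α_t) s = x^m`.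
    obtain ⟨h1, h2⟩ := Place.eq_of_hasLeading H.x_ne_zero (fun P hP => (hval P hP).2) fun h hh =>
      H.hasLeading_of_principal (s₁ := ∏ i ∈ Finset.univ.erase t, (y - algebraMap k F (α i)))
        (s₂ := x ^ (m - 1)) H.x_ne_zero
        (Subalgebra.prod_mem _ fun i _ => hysub (α i))
        (Subalgebra.prod_mem _ fun i _ => hysub (α i))
        (Subalgebra.pow_mem _ hxm _) (by simp)
        (by rw [H.mul_prod_erase t, mul_pow_sub_one H.m_ne_zero]) hval h hh
    exact ⟨h1, fun P hP => ⟨fun _ => (h2 P hP).1, (h2 P hP).2⟩⟩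
  · obtain ⟨q, hq⟩ := X_sub_C_dvd_sub_C_eval (p := rootPoly α) (a := b)
    have hq' : x ^ m - algebraMap k F (a ^ m) = (y - algebraMap k F b) * aeval y q := by
      have h := congrArg (aeval y) hq
      simp only [map_sub, map_mul, aeval_C, aeval_X] at h
      rw [← h, H.aeval_rootPoly, rootPoly_eval, hab]
    -- Here `π = y - b` and `s = p(x) = (x^m - a^m) / (x - a)`, whose value `m a^(m-1)` at the point
    -- is nonzero.
    let p : k[X] := ∑ i ∈ Finset.range m, X ^ i * C (a ^ (m - 1 - i))
    have hpx : aeval x p = ∑ i ∈ Finset.range m, x ^ i * (algebraMap k F a) ^ (m - 1 - i) := by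
      simp [p]
    have hpa : p.eval a ≠ 0 := by
      have : p.eval a = m * a ^ (m - 1) := by
        simp only [p, eval_finsetSum, eval_mul, eval_pow, eval_X, eval_C]
        rw [Finset.sum_congr rfl fun i hi => by
          rw [← pow_add, show i + (m - 1 - i) = m - 1 by
            have := Finset.mem_range.1 hi
            omega]]
        simp
      rw [this]
      exact mul_ne_zero H.cast_ne_zero (pow_ne_zero _ ha)
    have hval : ∀ P : Place k F, P.IsAt x y a b →
        P.val (aeval x p) = 1 ∧ P.val (y - algebraMap k F b) < 1 := fun P hP =>
      ⟨Place.val_eq_one_of_sub_lt hpa (Place.val_aeval_sub_lt hP.1 p), hP.2⟩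
    have hmemp : ∀ {z : F} (p : k[X]), z ∈ Algebra.adjoin k {x, y} →
        aeval z p ∈ Algebra.adjoin k {x, y} := fun p hz =>
      Algebra.adjoin_le (Set.singleton_subset_iff.2 hz) (aeval_mem_adjoin_singleton k _)
    obtain ⟨h1, h2⟩ := Place.eq_of_hasLeading (H.y_sub_ne_zero b)
      (fun P hP => (hval P hP).2) fun h hh =>
      H.hasLeading_of_principal (s₁ := aeval y q) (s₂ := aeval x p) (H.y_sub_ne_zero b)
        (hmemp p hxm) (hmemp q hym) (hmemp p hxm)
        (by rw [← hq', hpx, mul_comm, geom_sum₂_mul, map_pow]) rfl hval h hh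
    exact ⟨h1, fun P hP => ⟨fun h => absurd h ha, (h2 P hP).2⟩⟩

end IsKummer

end Points

/-! ### Expansions in powers of `x` and existence of the affine points -/

section NormalForm

open IntermediateField Polynomial
open scoped algebraAdjoinAdjoin

variable {k F : Type*} [Field k] [Field F] [Algebra k F] {r m : ℕ} {α : Fin r → k} {x y : F}

theorem coe_aeval_gen (y : F) (g : k[X]) :
    ((aeval (AdjoinSimple.gen k y) g : k⟮y⟯) : F) = aeval y g :=
  (aeval_algebraMap_apply F (AdjoinSimple.gen k y) g).symm

/-- The nonzero terms have orders that are distinct modulo `m`, so the value of the sum is the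
largest of the values of its terms. -/
theorem Place.val_monomial_le {P : Place k F} {e : ℤ} (hx : P.val x = exp e)
    (he : IsCoprime e (m : ℤ))
    (hK : ∀ p : k[X], aeval y p ≠ 0 → ∃ j : ℤ, P.val (aeval y p) = exp (j * m))
    (c : Fin m → k⟮y⟯) (i : Fin m) :
    P.val ((c i : F) * x ^ (i : ℕ)) ≤ P.val (∑ i, (c i : F) * x ^ (i : ℕ)) := by
  classical
  have hc : ∀ i, ∃ j : ℤ, c i ≠ 0 → P.val (c i : F) = exp (j * m) := by
    intro i
    by_cases hi : c i = 0
    · exact ⟨0, fun h => absurd hi h⟩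
    obtain ⟨p, q, hpq⟩ := (mem_adjoin_simple_iff k _).1 (c i).2
    have hci : (c i : F) ≠ 0 := by simpa using hi
    obtain ⟨j₁, h₁⟩ := hK p fun h => hci (by rw [hpq, h, zero_div])
    obtain ⟨j₂, h₂⟩ := hK q fun h => hci (by rw [hpq, h, div_zero])
    refine ⟨j₁ - j₂, fun _ => ?_⟩
    rw [hpq, map_div₀, h₁, h₂, ← exp_sub, sub_mul]
  choose j hj using hc
  have hterm : ∀ i, c i ≠ 0 →
      P.val ((c i : F) * x ^ (i : ℕ)) = exp (j i * m + (i : ℕ) * e) := by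
    intro i hi
    rw [map_mul, map_pow, hj i hi, hx, ← exp_nsmul, ← exp_add, nsmul_eq_mul]
  obtain ⟨i₀, -, hmax⟩ := Finset.exists_max_image Finset.univ
    (fun i => P.val ((c i : F) * x ^ (i : ℕ))) ⟨i, Finset.mem_univ i⟩
  by_cases h0 : c i₀ = 0
  · have := hmax i (Finset.mem_univ i)
    rw [h0] at this
    exact this.trans (by simp)
  · rw [Valuation.map_sum_eq_of_lt P.val (Finset.mem_univ i₀)]
    · exact hmax i (Finset.mem_univ i)
    · intro l hl
      refine lt_of_le_of_ne (hmax l (Finset.mem_univ l)) fun heq => ?_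
      have hne : l ≠ i₀ := by simpa using hl
      rw [hterm i₀ h0] at heq
      by_cases hl0 : c l = 0
      · rw [hl0] at heq
        simp at heq
      · rw [hterm l hl0, exp_inj] at heq
        exact hne (monomial_exponent_injective he j heq)

theorem Place.val_aeval_of_one_lt {P : Place k F} (hP : 1 < P.val y) {p : k[X]} (hp : p ≠ 0) :
    P.val (aeval y p) = P.val y ^ p.natDegree := by
  have : P.val.IsTrivialOn k := ⟨P.trivial_on⟩
  exact valuation_aeval_eq_valuation_X_pow_natDegree_of_one_lt_valuation_X y hP hp

namespace IsKummer

theorem val_monomial_le_of_isAtInfinity (H : IsKummer m α x y) {P : Place k F}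
    (hP : P.IsAtInfinity x y) (c : Fin m → k⟮y⟯) (i : Fin m) :
    P.val ((c i : F) * x ^ (i : ℕ)) ≤ P.val (∑ i, (c i : F) * x ^ (i : ℕ)) := by
  obtain ⟨hx, hy, -⟩ := H.place_at_infinity.2 P hP
  refine Place.val_monomial_le hx (Nat.isCoprime_iff_coprime.2 H.coprime) (fun p hp => ?_) c i
  refine ⟨p.natDegree, ?_⟩
  rw [Place.val_aeval_of_one_lt (H.isAtInfinity_iff.1 hP) (fun h => hp (by simp [h])), hy,
    ← exp_nsmul, nsmul_eq_mul]

/-- Independence of `1, x, …, x^(m-1)` over `k(y)` is read off at `P_∞`, where no cancellation is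
possible. It yields `[F : k(y)] = m`. -/
theorem eq_zero_of_sum_eq_zero (H : IsKummer m α x y) {c : Fin m → k⟮y⟯}
    (hc : ∑ i, (c i : F) * x ^ (i : ℕ) = 0) (i : Fin m) : c i = 0 := by
  obtain ⟨P, hP⟩ := H.exists_isAtInfinity
  have h := H.val_monomial_le_of_isAtInfinity hP c i
  rw [hc, map_zero, le_zero_iff, map_eq_zero] at h
  have h1 := (mul_eq_zero.1 h).resolve_right (pow_ne_zero _ H.x_ne_zero)
  exact_mod_cast h1

theorem aeval_eq_zero_of_sum_eq_zero (H : IsKummer m α x y) {g : Fin m → k[X]}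
    (hg : ∑ i, aeval y (g i) * x ^ (i : ℕ) = 0) (i : Fin m) : g i = 0 := by
  have h := H.eq_zero_of_sum_eq_zero (c := fun i => aeval (AdjoinSimple.gen k y) (g i)) (by
    rw [← hg]
    exact Finset.sum_congr rfl fun i _ => by rw [coe_aeval_gen]) i
  have h' := congrArg (algebraMap k⟮y⟯ F) h
  rw [← aeval_algebraMap_apply, AdjoinSimple.algebraMap_gen, map_zero] at h'
  by_contra h0
  exact H.aeval_ne_zero h0 h'

theorem linearIndependent (H : IsKummer m α x y) :
    LinearIndependent k⟮y⟯ fun i : Fin m => x ^ (i : ℕ) := by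
  rw [Fintype.linearIndependent_iff]
  intro c hc i
  exact H.eq_zero_of_sum_eq_zero (c := c) (by simpa [Algebra.smul_def] using hc) i

theorem finrank_eq (H : IsKummer m α x y) : Module.finrank k⟮y⟯ F = m := by
  have hspan : ⊤ ≤ Submodule.span k⟮y⟯ (Set.range fun i : Fin m => x ^ (i : ℕ)) := by
    intro h _
    obtain ⟨c, rfl⟩ := H.exists_sum_eq h
    refine Submodule.sum_mem _ fun i _ => ?_
    have := Submodule.smul_mem (Submodule.span k⟮y⟯ (Set.range fun i : Fin m => x ^ (i : ℕ)))
      (c i) (Submodule.subset_span ⟨i, rfl⟩)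
    simpa [Algebra.smul_def] using this
  simpa using Module.finrank_eq_card_basis (Module.Basis.mk H.linearIndependent hspan)

theorem minpoly_eq (H : IsKummer m α x y) :
    minpoly k⟮y⟯ x = X ^ m - C (aeval (AdjoinSimple.gen k y) (rootPoly α)) := by
  refine (eq_of_monic_of_dvd_of_natDegree_le (minpoly.monic H.isIntegral_x)
    (monic_X_pow_sub_C _ H.m_ne_zero) (minpoly.dvd _ _ H.aeval_X_pow_sub_C) ?_).symm
  rw [natDegree_X_pow_sub_C, ← adjoin.finrank H.isIntegral_x, H.adjoin_x_eq_top, finrank_top',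
    H.finrank_eq]

theorem adjoin_x_eq_top' (H : IsKummer m α x y) : Algebra.adjoin k⟮y⟯ {x} = ⊤ := by
  rw [← adjoin_simple_toSubalgebra_of_isAlgebraic H.isIntegral_x.isAlgebraic, H.adjoin_x_eq_top,
    top_toSubalgebra]

theorem isIntegral_adjoin_x (H : IsKummer m α x y) : IsIntegral (Algebra.adjoin k {y}) x := by
  refine ⟨X ^ m - C ⟨aeval y (rootPoly α), aeval_mem_adjoin_singleton k y⟩,
    monic_X_pow_sub_C _ H.m_ne_zero, ?_⟩
  rw [eval₂_sub, eval₂_X_pow, eval₂_C]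
  exact sub_eq_zero.2 H.aeval_rootPoly.symm

/-- Up to sign the discriminant of the powers of `x` is the norm of `m x^(m-1)`, and the norm of `x`
is `± x^m`. -/
theorem exists_discr_eq (H : IsKummer m α x y) :
    ∃ (c : k) (pb : PowerBasis k⟮y⟯ F), c ≠ 0 ∧ pb.gen = x ∧
      algebraMap k⟮y⟯ F (Algebra.discr k⟮y⟯ pb.basis) =
        algebraMap k F c * (x ^ m) ^ (m - 1) := by
  have := H.finiteDimensional
  have := H.isSeparable
  let pb := PowerBasis.ofAdjoinEqTop H.isIntegral_x H.adjoin_x_eq_top'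
  have hgen : pb.gen = x := rfl
  set φ := aeval (AdjoinSimple.gen k y) (rootPoly α) with hφ
  have hφ' : algebraMap k⟮y⟯ F φ = x ^ m := by
    rw [← H.aeval_rootPoly, hφ, ← aeval_algebraMap_apply, AdjoinSimple.algebraMap_gen]
  have hnorm : Algebra.norm k⟮y⟯ x = (-1) ^ pb.dim * (-φ) := by
    have := Algebra.PowerBasis.norm_gen_eq_coeff_zero_minpoly pb
    rw [hgen, H.minpoly_eq] at this
    rw [this, coeff_sub, coeff_C_zero, coeff_X_pow, if_neg H.m_ne_zero.symm, zero_sub]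
  obtain ⟨a, ha⟩ : ∃ a : ℕ, Algebra.discr k⟮y⟯ pb.basis =
      (-1) ^ a * Algebra.norm k⟮y⟯ (aeval x (minpoly k⟮y⟯ x).derivative) :=
    ⟨_, Algebra.discr_powerBasis_eq_norm k⟮y⟯ pb⟩
  have hder : aeval x (minpoly k⟮y⟯ x).derivative = algebraMap k⟮y⟯ F (m : k⟮y⟯) * x ^ (m - 1) := by
    rw [H.minpoly_eq]
    simp [derivative_X_pow]
  rw [hder, map_mul, map_pow, Algebra.norm_algebraMap, hnorm] at ha
  refine ⟨(-1) ^ a * ((m : k) ^ Module.finrank k⟮y⟯ F * ((-1) ^ pb.dim * (-1)) ^ (m - 1)), pb,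
    ?_, hgen, ?_⟩
  · have h1 : (-1 : k) ≠ 0 := neg_ne_zero.2 one_ne_zero
    exact mul_ne_zero (pow_ne_zero _ h1) (mul_ne_zero (pow_ne_zero _ H.cast_ne_zero)
      (pow_ne_zero _ (mul_ne_zero (pow_ne_zero _ h1) h1)))
  · rw [ha, ← hφ']
    simp only [map_mul, map_pow, map_neg, map_one, map_natCast]
    ring

/-- Normal form of integral functions, up to the discriminant. -/
theorem exists_normalForm (H : IsKummer m α x y) {h : F}
    (hh : IsIntegral (Algebra.adjoin k {y}) h) :
    ∃ g : Fin m → k[X], (x ^ m) ^ (m - 1) * h = ∑ i, aeval y (g i) * x ^ (i : ℕ) := by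
  have := H.finiteDimensional
  have := H.isSeparable
  have := isPrincipalIdealRing_adjoin H.transcendental
  obtain ⟨c, pb, hc, hgen, hd⟩ := H.exists_discr_eq
  have hmem := Algebra.discr_mul_isIntegral_mem_adjoin (R := Algebra.adjoin k {y}) k⟮y⟯
    (B := pb) (by rw [hgen]; exact H.isIntegral_adjoin_x) hh
  rw [Algebra.smul_def, hd, hgen] at hmem
  have hmem' : (x ^ m) ^ (m - 1) * h ∈ Algebra.adjoin (Algebra.adjoin k {y}) {x} := by
    have h1 := Subalgebra.mul_mem _ (Subalgebra.algebraMap_mem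
      (Algebra.adjoin (Algebra.adjoin k {y}) {x}) (algebraMap k (Algebra.adjoin k {y}) c⁻¹)) hmem
    rw [← IsScalarTower.algebraMap_apply k (Algebra.adjoin k {y}) F] at h1
    have e : algebraMap k F c⁻¹ * (algebraMap k F c * (x ^ m) ^ (m - 1) * h) =
        (x ^ m) ^ (m - 1) * h := by
      have : algebraMap k F c⁻¹ * algebraMap k F c = 1 := by
        rw [← map_mul, inv_mul_cancel₀ hc, map_one]
      linear_combination ((x ^ m) ^ (m - 1) * h) * this
    rwa [e] at h1
  rw [Algebra.adjoin_singleton_eq_range_aeval (Algebra.adjoin k {y})] at hmem'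
  obtain ⟨p, hp⟩ := hmem'
  have hp' : aeval x p = (x ^ m) ^ (m - 1) * h := hp
  let φ : Algebra.adjoin k {y} := ⟨aeval y (rootPoly α), aeval_mem_adjoin_singleton k y⟩
  have hmon := monic_X_pow_sub_C φ H.m_ne_zero
  have hroot : aeval x (X ^ m - C φ) = 0 := by
    rw [map_sub, map_pow, aeval_X, aeval_C]
    exact sub_eq_zero.2 H.aeval_rootPoly.symm
  have h1 := aeval_modByMonic_eq_self_of_root (p := p) hroot
  have hdeg : (p %ₘ (X ^ m - C φ)).natDegree < m := by
    have := natDegree_modByMonic_lt p hmon (by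
      intro h1
      have := congrArg natDegree h1
      rw [natDegree_X_pow_sub_C, natDegree_one] at this
      exact H.m_ne_zero this)
    rwa [natDegree_X_pow_sub_C] at this
  have hco : ∀ i : Fin m, ∃ g : k[X], aeval y g = ((p %ₘ (X ^ m - C φ)).coeff i : F) := by
    intro i
    exact (Algebra.adjoin_singleton_eq_range_aeval k y).le ((p %ₘ (X ^ m - C φ)).coeff i).2
  choose g hg using hco
  refine ⟨g, ?_⟩
  rw [← hp', ← h1, aeval_eq_sum_range' hdeg, Finset.sum_range]
  refine Finset.sum_congr rfl fun i _ => ?_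
  rw [hg, Algebra.smul_def]
  rfl

/-- Relations between `x` and `y` hold at all points of the curve. -/
theorem eval₂_eq_zero (H : IsKummer m α x y) {a b : k} (hab : ∏ i, (b - α i) = a ^ m)
    {T : k[X][X]} (hT : T.eval₂ (aeval y : k[X] →ₐ[k] F).toRingHom x = 0) :
    T.eval₂ (evalRingHom b) a = 0 := by
  have hmon := monic_X_pow_sub_C (rootPoly α) H.m_ne_zero
  have hdiv := modByMonic_add_div T (X ^ m - C (rootPoly α))
  have hdeg : (T %ₘ (X ^ m - C (rootPoly α))).natDegree < m := by
    have := natDegree_modByMonic_lt T hmon (by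
      intro h1
      have := congrArg natDegree h1
      rw [natDegree_X_pow_sub_C, natDegree_one] at this
      exact H.m_ne_zero this)
    rwa [natDegree_X_pow_sub_C] at this
  -- The remainder has degree below `m` in `x` and still vanishes on the curve, so independence
  -- kills its coefficients: `T` is a multiple of the equation of the curve.
  have h0 : T %ₘ (X ^ m - C (rootPoly α)) = 0 := by
    have h1 : (T %ₘ (X ^ m - C (rootPoly α))).eval₂ (aeval y : k[X] →ₐ[k] F).toRingHom x = 0 := by
      rw [← hdiv, eval₂_add, eval₂_mul, eval₂_sub, eval₂_X_pow, eval₂_C] at hT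
      have h2 : (aeval y : k[X] →ₐ[k] F).toRingHom (rootPoly α) = x ^ m := H.aeval_rootPoly
      rw [h2, sub_self, zero_mul, add_zero] at hT
      exact hT
    rw [eval₂_eq_sum_range' _ hdeg, Finset.sum_range] at h1
    have h2 := H.aeval_eq_zero_of_sum_eq_zero
      (g := fun i => (T %ₘ (X ^ m - C (rootPoly α))).coeff i) h1
    ext1 n
    by_cases hn : n < m
    · exact h2 ⟨n, hn⟩
    · rw [coeff_eq_zero_of_natDegree_lt (by omega), coeff_zero]
  rw [← hdiv, h0, zero_add, eval₂_mul, eval₂_sub, eval₂_X_pow, eval₂_C, coe_evalRingHom,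
    rootPoly_eval, hab, sub_self, zero_mul]

/-- For `a = 0` take a pole of `(y - α_t)⁻¹`. For `a ≠ 0` take a prime containing `x - a` and `y -
b` in the integral closure of `k[y]`. -/
theorem exists_isAt (H : IsKummer m α x y) {a b : k} (hab : ∏ i, (b - α i) = a ^ m) :
    ∃ P : Place k F, P.IsAt x y a b := by
  have := H.finiteDimensional
  have := H.isSeparable
  have hyi : IsIntegral (Algebra.adjoin k {y}) (y - algebraMap k F b) :=
    isIntegral_algebraMap (x := (⟨y - algebraMap k F b, sub_mem
      (Algebra.self_mem_adjoin_singleton k y) (Subalgebra.algebraMap_mem _ b)⟩ :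
        Algebra.adjoin k {y}))
  have hai : ∀ a, IsIntegral (Algebra.adjoin k {y}) (algebraMap k F a) := fun a =>
    isIntegral_algebraMap (x := algebraMap k (Algebra.adjoin k {y}) a)
  by_cases ha : a = 0
  · subst ha
    obtain ⟨t, rfl⟩ := H.exists_eq_of_isAt_zero hab
    have hadj : k⟮(y - algebraMap k F (α t))⁻¹⟯ = k⟮y⟯ := by
      rw [adjoin_inv_eq]
      refine le_antisymm ?_ ?_
      · rw [adjoin_simple_le_iff]
        exact sub_mem (mem_adjoin_simple_self k y) (IntermediateField.algebraMap_mem _ _)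
      · rw [adjoin_simple_le_iff]
        have := add_mem (mem_adjoin_simple_self k (y - algebraMap k F (α t)))
          (IntermediateField.algebraMap_mem k⟮y - algebraMap k F (α t)⟯ (α t))
        rwa [sub_add_cancel] at this
    have : FiniteDimensional k⟮(y - algebraMap k F (α t))⁻¹⟯ F := by rwa [hadj]
    have : Algebra.IsSeparable k⟮(y - algebraMap k F (α t))⁻¹⟯ F := by rwa [hadj]
    have htr : Transcendental k (y - algebraMap k F (α t))⁻¹ := fun h => H.transcendental (by
      have h1 := h.inv
      rw [inv_inv] at h1
      have := h1.add (isAlgebraic_algebraMap (α t))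
      rwa [sub_add_cancel] at this)
    obtain ⟨P, hP⟩ := exists_place_one_lt_val htr
    rw [map_inv₀, one_lt_inv₀ (zero_lt_iff.2 ((Valuation.ne_zero_iff _).2 (H.y_sub_ne_zero _)))]
      at hP
    refine ⟨P, ?_, hP⟩
    rw [map_zero, sub_zero, ← Place.val_pow_lt_one H.m_ne_zero, ← H.mul_prod_erase t, map_mul,
      H.val_prod_erase hP, mul_one]
    exact hP
  · let X₀ : integralClosure (Algebra.adjoin k {y}) F :=
      ⟨x - algebraMap k F a, H.isIntegral_adjoin_x.sub (hai a)⟩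
    let Y₀ : integralClosure (Algebra.adjoin k {y}) F := ⟨y - algebraMap k F b, hyi⟩
    obtain ⟨P, -, hP⟩ := exists_place_of_ideal H.transcendental (Ideal.span {X₀, Y₀}) (by
      intro htop
      obtain ⟨u, v, huv⟩ := Ideal.mem_span_pair.1 ((Ideal.eq_top_iff_one _).1 htop)
      have huv' : (u : F) * (x - algebraMap k F a) + v * (y - algebraMap k F b) = 1 :=
        congrArg Subtype.val huv
      obtain ⟨g₁, hg₁⟩ := H.exists_normalForm u.2
      obtain ⟨g₂, hg₂⟩ := H.exists_normalForm v.2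
      -- If `u (x - a) + v (y - b) = 1`, multiplying by the discriminant factor `(x^m)^(m-1)` makes
      -- this a polynomial relation; evaluated at `(a, b)` it reads `(a^m)^(m-1) = 0`.
      have h := H.eval₂_eq_zero hab (T := C (rootPoly α) ^ (m - 1) -
        ((∑ i, C (g₁ i) * X ^ (i : ℕ)) * (X - C (C a)) +
          (∑ i, C (g₂ i) * X ^ (i : ℕ)) * C (X - C b))) (by
        have e : ∀ g : Fin m → k[X], eval₂ (aeval y : k[X] →ₐ[k] F).toRingHom x
            (∑ i, C (g i) * X ^ (i : ℕ)) = ∑ i, aeval y (g i) * x ^ (i : ℕ) := by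
          intro g
          simp [eval₂_finsetSum]
        rw [eval₂_sub, eval₂_add, eval₂_mul, eval₂_mul, e, e, ← hg₁, ← hg₂]
        simp only [eval₂_pow, eval₂_C, eval₂_sub, eval₂_X]
        have e1 : (aeval y : k[X] →ₐ[k] F).toRingHom (rootPoly α) = x ^ m := H.aeval_rootPoly
        have e2 : (aeval y : k[X] →ₐ[k] F).toRingHom (C a) = algebraMap k F a := aeval_C y a
        have e3 : (aeval y : k[X] →ₐ[k] F).toRingHom (X - C b) = y - algebraMap k F b := by
          simp
        rw [e1, e2, e3]
        linear_combination (-(x ^ m) ^ (m - 1)) * huv')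
      simp only [eval₂_sub, eval₂_add, eval₂_mul, eval₂_pow, eval₂_C, eval₂_X, coe_evalRingHom,
        eval_C, sub_self, mul_zero, eval_sub, eval_X, add_zero, sub_zero, rootPoly_eval, hab] at h
      exact pow_ne_zero _ (pow_ne_zero _ ha) h) (by
      intro hbot
      have h1 : Y₀ ∈ (⊥ : Ideal (integralClosure (Algebra.adjoin k {y}) F)) := by
        rw [← hbot]
        exact Ideal.subset_span (by simp)
      exact H.y_sub_ne_zero b (congrArg Subtype.val ((Submodule.mem_bot _).1 h1)))
    exact ⟨P, hP X₀ (Ideal.subset_span (by simp)), hP Y₀ (Ideal.subset_span (by simp))⟩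

end IsKummer

end NormalForm

/-! ### Functions with small poles on `x = 0` -/

section ConstantFunctions

open IntermediateField Polynomial
open scoped algebraAdjoinAdjoin

variable {k F : Type*} [Field k] [Field F] [Algebra k F] {r m : ℕ} {α : Fin r → k} {x y : F}

theorem sum_rootMultiplicity_le (hα : Function.Injective α) {p : k[X]} (hp : p ≠ 0) :
    ∑ t, p.rootMultiplicity (α t) ≤ p.natDegree := by
  have hdvd : ∏ t, (X - C (α t)) ^ p.rootMultiplicity (α t) ∣ p := by
    refine Finset.prod_dvd_of_coprime (fun s _ t _ hst => ?_) fun t _ =>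
      pow_rootMultiplicity_dvd p (α t)
    exact (pairwise_coprime_X_sub_C hα hst).pow
  have h := natDegree_le_of_dvd hdvd hp
  rwa [natDegree_prod_of_monic _ _ fun t _ => (monic_X_sub_C (α t)).pow _,
    Finset.sum_congr rfl fun t _ => by rw [natDegree_pow, natDegree_X_sub_C, mul_one]] at h

namespace IsKummer

theorem val_x_of_isAt (H : IsKummer m α x y) {P : Place k F} {t : Fin r}
    (hP : P.IsAt x y 0 (α t)) : P.val x = exp (-1) :=
  ((H.place_at_point (H.eq_of_isAt hP)).2 P hP).1 rfl

theorem val_y_sub_of_isAt (H : IsKummer m α x y) {P : Place k F} {t : Fin r}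
    (hP : P.IsAt x y 0 (α t)) : P.val (y - algebraMap k F (α t)) = exp (-m : ℤ) := by
  have h := congrArg P.val (H.mul_prod_erase t)
  rw [map_mul, H.val_prod_erase hP.2, mul_one, map_pow, H.val_x_of_isAt hP, ← exp_nsmul] at h
  rw [h]
  simp

theorem val_aeval_of_isAt (H : IsKummer m α x y) {P : Place k F} {t : Fin r}
    (hP : P.IsAt x y 0 (α t)) {p : k[X]} (hp : p ≠ 0) :
    P.val (aeval y p) = exp (-(p.rootMultiplicity (α t)) * m : ℤ) := by
  obtain ⟨q, hq, hdvd⟩ := exists_eq_pow_rootMultiplicity_mul_and_not_dvd p hp (α t)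
  rw [dvd_iff_isRoot, IsRoot.def] at hdvd
  have hval : P.val (aeval y q) = 1 :=
    Place.val_eq_one_of_sub_lt hdvd (Place.val_aeval_sub_lt hP.2 q)
  have h := congrArg (fun p => P.val (aeval y p)) hq
  simp only [map_mul, map_pow, map_sub, aeval_X, aeval_C, hval, mul_one,
    H.val_y_sub_of_isAt hP] at h
  rw [h, ← exp_nsmul]
  simp

theorem val_monomial_le_of_isAt (H : IsKummer m α x y) {P : Place k F} {t : Fin r}
    (hP : P.IsAt x y 0 (α t)) (c : Fin m → k⟮y⟯) (i : Fin m) :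
    P.val ((c i : F) * x ^ (i : ℕ)) ≤ P.val (∑ i, (c i : F) * x ^ (i : ℕ)) :=
  Place.val_monomial_le (H.val_x_of_isAt hP) (isCoprime_one_left.neg_left) (fun p hp =>
    ⟨_, H.val_aeval_of_isAt hP (fun h => hp (by simp [h]))⟩) c i

/-- Functions with small poles at the points `x = 0`, no other poles and a zero at infinity
vanish. -/
theorem eq_zero_of_val_le (H : IsKummer m α x y) {R : Place k F} (hR : R.IsAtInfinity x y)
    {Q : Fin r → Place k F} (hQ : ∀ t, (Q t).IsAt x y 0 (α t)) {n : Fin r → ℕ}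
    (hn : ∀ t, n t < m)
    (hcount : ∀ i < m, m * (Finset.univ.filter fun t => m ≤ n t + i).card ≤ r * i) {f : F}
    (hfQ : ∀ t, (Q t).val f ≤ exp (n t : ℤ))
    (hf : ∀ P : Place k F, P.val y ≤ 1 → (∀ t, P ≠ Q t) → P.val f ≤ 1)
    (hfR : R.val f < 1) : f = 0 := by
  have := H.finiteDimensional
  have := H.isSeparable
  have hm0 := H.m_ne_zero
  -- As `n t < m`, the factor `x^m` cancels all finite poles of `f`.
  have hint : IsIntegral (Algebra.adjoin k {y}) (x ^ m * f) := by
    refine isIntegral_of_val_le_one H.transcendental fun P hP => ?_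
    by_cases h : ∃ t, P = Q t
    · obtain ⟨t, rfl⟩ := h
      rw [map_mul, map_pow, H.val_x_of_isAt (hQ t), ← exp_nsmul]
      calc exp (m • (-1 : ℤ)) * (Q t).val f ≤ exp (m • (-1 : ℤ)) * exp (n t : ℤ) := by
            gcongr
            exact hfQ t
        _ = exp (m • (-1 : ℤ) + n t) := (exp_add _ _).symm
        _ ≤ 1 := by
          rw [← exp_zero, exp_le_exp]
          have := hn t
          simp
          omega
    · push Not at h
      rw [map_mul, map_pow]
      exact mul_le_one' (pow_le_one' (H.val_x_le_one hP) m) (hf P hP h)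
  obtain ⟨g, hg⟩ := H.exists_normalForm hint
  have hg' : (x ^ m) ^ m * f = ∑ i, aeval y (g i) * x ^ (i : ℕ) := by
    rw [← hg, ← mul_assoc, ← pow_succ, Nat.sub_add_cancel (Nat.pos_of_ne_zero hm0)]
  let c : Fin m → k⟮y⟯ := fun i => aeval (AdjoinSimple.gen k y) (g i)
  have hc : ∀ i, (c i : F) = aeval y (g i) :=
    fun i => coe_aeval_gen y (g i)
  obtain ⟨hRx, hRy, -⟩ := H.place_at_infinity.2 R hR
  have hzero : ∀ i, g i = 0 := by
    intro i
    by_contra hgi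
    have hRle := H.val_monomial_le_of_isAtInfinity hR c i
    simp only [hc] at hRle
    rw [← hg', map_mul, map_mul, map_pow, map_pow, map_pow,
      Place.val_aeval_of_one_lt (H.isAtInfinity_iff.1 hR) hgi, hRx, hRy] at hRle
    have hRlt : exp ((m : ℤ)) ^ (g i).natDegree * exp (r : ℤ) ^ (i : ℕ) <
        (exp (r : ℤ) ^ m) ^ m := by
      refine hRle.trans_lt ?_
      have hpos : (0 : ℤᵐ⁰) < (exp (r : ℤ) ^ m) ^ m := by
        simp [zero_lt_iff]
      calc (exp (r : ℤ) ^ m) ^ m * R.val f < (exp (r : ℤ) ^ m) ^ m * 1 :=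
            mul_lt_mul_of_pos_left hfR hpos
        _ = _ := mul_one _
    rw [← exp_nsmul, ← exp_nsmul, ← exp_nsmul, ← exp_nsmul, ← exp_add, exp_lt_exp] at hRlt
    simp only [nsmul_eq_mul] at hRlt
    -- The pole order of the `i`-th term at infinity is at most that of the sum, and `f` vanishes
    -- there.
    have hdeg : m * (g i).natDegree + r * i < r * m * m := by
      zify
      linarith
    -- The order at `Q t` gives `m² ≤ m · mult + i + n t` with `i + n t < 2m`: the multiplicity is
    -- at least `m`, or at least `m - 1` when `m ≤ n t + i`.
    have hmult : ∀ t, m ≤ (g i).rootMultiplicity (α t) + (if m ≤ n t + i then 1 else 0) := by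
      intro t
      have hle := H.val_monomial_le_of_isAt (hQ t) c i
      simp only [hc] at hle
      rw [← hg', map_mul, map_mul, map_pow, map_pow, map_pow, H.val_aeval_of_isAt (hQ t) hgi,
        H.val_x_of_isAt (hQ t)] at hle
      have hle2 := hle.trans (mul_le_mul_right (hfQ t) _)
      rw [← exp_nsmul, ← exp_nsmul, ← exp_nsmul, ← exp_add, ← exp_add, exp_le_exp] at hle2
      simp only [nsmul_eq_mul] at hle2
      have hle3 : m * m ≤ (g i).rootMultiplicity (α t) * m + i + n t := by
        zify
        linarith
      have hi := i.2
      have hnt := hn t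
      split_ifs with hcase
      · by_contra hlt
        have h1 : (g i).rootMultiplicity (α t) + 2 ≤ m := by omega
        have h2 := Nat.mul_le_mul_right m h1
        rw [add_mul] at h2
        omega
      · by_contra hlt
        have h1 : (g i).rootMultiplicity (α t) + 1 ≤ m := by omega
        have h2 := Nat.mul_le_mul_right m h1
        rw [add_mul] at h2
        omega
    have hsum := Finset.sum_le_sum fun t (_ : t ∈ Finset.univ) => hmult t
    rw [Finset.sum_add_distrib, ← Finset.card_filter] at hsum
    simp only [Finset.sum_const, Finset.card_univ, Fintype.card_fin, smul_eq_mul] at hsum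
    have h1 := sum_rootMultiplicity_le H.injective hgi
    have h2 := hcount i i.2
    -- Summing over the roots gives `r m ≤ deg g_i + #{t : m ≤ n t + i}`. Times `m`, and with
    -- `hcount`, this contradicts `hdeg`.
    have h3 : m * (r * m) ≤
        m * ((g i).natDegree + (Finset.univ.filter fun t => m ≤ n t + i).card) :=
      Nat.mul_le_mul_left m (hsum.trans (by omega))
    rw [mul_add] at h3
    have h4 : m * (r * m) = r * m * m := by ring
    omega
  have : (x ^ m) ^ m * f = 0 := by
    rw [hg']
    exact Finset.sum_eq_zero fun i _ => by rw [hzero i]; simp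
  exact (mul_eq_zero.1 this).resolve_left (pow_ne_zero _ (pow_ne_zero _ H.x_ne_zero))

end IsKummer

end ConstantFunctions

/-! ### Riemann's inequality -/

section Riemann

open IntermediateField Polynomial

variable {k F : Type*} [Field k] [Field F] [Algebra k F] {r m : ℕ} {α : Fin r → k} {x y : F}

/-- The genus `∑ j, (l_j - 1)` of the curve. -/
def kummerGenus (r m : ℕ) : ℕ := ∑ j ∈ Finset.Icc 1 (m - 1), (lnum r m j - 1)

theorem one_le_lnum {j : ℕ} (hr : 0 < r) (hj : j < m) : 1 ≤ lnum r m j := by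
  have : r * j / m < r := Nat.div_lt_of_lt_mul (by
    rw [mul_comm m r]
    exact Nat.mul_lt_mul_of_pos_left hj hr)
  unfold lnum
  omega

theorem lnum_self (hm : m ≠ 0) : lnum r m m = 0 := by
  rw [lnum, Nat.mul_div_cancel _ (Nat.pos_of_ne_zero hm), Nat.sub_self]

/-- With `j = m - i`, the term `j = m` contributes `N + 1` and each other term `N - (l_j - 1)`. The
condition `r ≤ N` keeps the subtractions from truncating. -/
theorem sum_lnum_add (hr : 0 < r) (hm : m ≠ 0) {N : ℕ} (hN : r ≤ N) :
    (∑ i : Fin m, (N + 1 - lnum r m (m - i))) + kummerGenus r m = m * N + 1 := by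
  rw [Fin.sum_univ_eq_sum_range (fun i => N + 1 - lnum r m (m - i)),
    ← Finset.sum_range_reflect]
  obtain ⟨M, rfl⟩ := Nat.exists_eq_succ_of_ne_zero hm
  have h1 : ∑ j ∈ Finset.range (M + 1), (N + 1 - lnum r (M + 1) (M + 1 - (M + 1 - 1 - j))) =
      ∑ j ∈ Finset.range (M + 1), (N + 1 - lnum r (M + 1) (j + 1)) :=
    Finset.sum_congr rfl fun j hj => by
      have := Finset.mem_range.1 hj
      rw [show M + 1 - (M + 1 - 1 - j) = j + 1 by omega]
  rw [Nat.succ_eq_add_one] at *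
  rw [h1, Finset.sum_range_succ, lnum_self hm, kummerGenus]
  have h2 : ∑ j ∈ Finset.Icc 1 (M + 1 - 1), (lnum r (M + 1) j - 1) =
      ∑ j ∈ Finset.range M, (lnum r (M + 1) (j + 1) - 1) := by
    rw [Finset.range_eq_Ico, Finset.sum_Ico_add' (fun j => lnum r (M + 1) j - 1) 0 M 1]
    rfl
  rw [h2, add_right_comm, ← Finset.sum_add_distrib, Finset.sum_congr rfl (g := fun _ => N)]
  · simp
    ring
  · intro j hj
    have := Finset.mem_range.1 hj
    have h3 := one_le_lnum (j := j + 1) hr (show j + 1 < M + 1 by omega)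
    have h4 : lnum r (M + 1) (j + 1) ≤ r := Nat.sub_le _ _
    omega

namespace IsKummer

theorem eq_infinity (H : IsKummer m α x y) {R P : Place k F} (hR : R.IsAtInfinity x y)
    (hP : 1 < P.val y) : P = R :=
  H.place_at_infinity.1 (H.isAtInfinity_iff.2 hP) hR

theorem degree_of_isAtInfinity (H : IsKummer m α x y) {R : Place k F}
    (hR : R.IsAtInfinity x y) : R.degree = 1 :=
  R.degree_eq_one (H.place_at_infinity.2 R hR).2.2

theorem degree_of_isAt (H : IsKummer m α x y) {P : Place k F} {a b : k}
    (hP : P.IsAt x y a b) : P.degree = 1 :=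
  P.degree_eq_one ((H.place_at_point (H.eq_of_isAt hP)).2 P hP).2

theorem finite_residue (H : IsKummer m α x y) (P : Place k F) :
    Module.Finite k (P.ring ⧸ P.maxIdeal) := by
  have := H.finiteDimensional
  have := H.isSeparable
  by_cases hP : P.val y ≤ 1
  · exact (exists_zeroDivisor_polynomial H.transcendental P hP).1
  · have h := H.degree_of_isAtInfinity (H.isAtInfinity_iff.2 (not_le.1 hP))
    -- `Module.finrank` is `0` in infinite dimension, so degree one forces finiteness.
    exact FiniteDimensional.of_finrank_pos (h.symm ▸ one_pos : 0 < P.degree)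

theorem exists_zeros (H : IsKummer m α x y) :
    ∃ Q : Fin r → Place k F, ∀ t, (Q t).IsAt x y 0 (α t) := by
  have h : ∀ t, ∃ P : Place k F, P.IsAt x y 0 (α t) := fun t => H.exists_isAt (by
    rw [zero_pow H.m_ne_zero]
    exact Finset.prod_eq_zero (Finset.mem_univ t) (sub_self _))
  choose Q hQ using h
  exact ⟨Q, hQ⟩

/-- Subtracting the value of `f` at infinity leaves the pole bounds intact and produces a zero
there. -/
theorem eq_algebraMap_of_mem_L (H : IsKummer m α x y)
    {Q : Fin r → Place k F} (hQ : ∀ t, (Q t).IsAt x y 0 (α t)) {n : Fin r → ℕ}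
    (hn : ∀ t, n t < m)
    (hcount : ∀ i < m, m * (Finset.univ.filter fun t => m ≤ n t + i).card ≤ r * i)
    {E : Divisor k F} (hEQ : ∀ t, E (Q t) = n t) (hE : ∀ P, (∀ t, P ≠ Q t) → E P = 0) {f : F}
    (hf : f ∈ E.L) : ∃ c : k, f = algebraMap k F c := by
  obtain ⟨R, hR⟩ := H.exists_isAtInfinity
  have hRQ : ∀ t, R ≠ Q t := by
    rintro t rfl
    exact (H.isAtInfinity_iff.1 hR).not_ge (Place.val_le_one_of_sub_lt (hQ t).2)
  have hreg : ∀ P, (∀ t, P ≠ Q t) → P.val f ≤ 1 := fun P hP => by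
    have := hf P
    rwa [hE P hP, exp_zero] at this
  obtain ⟨c, hc⟩ := (H.place_at_infinity.2 R hR).2.2 f (hreg R hRQ)
  refine ⟨c, sub_eq_zero.1
    (H.eq_zero_of_val_le hR hQ hn hcount (fun t => ?_) (fun P _ hP => ?_) hc)⟩
  · refine (Q t).val.map_sub_le ?_ (((Q t).val_algebraMap_le c).trans ?_)
    · have := hf (Q t)
      rwa [hEQ t] at this
    · rw [← exp_zero, exp_le_exp]
      positivity
  · exact P.val.map_sub_le (hreg P hP) (P.val_algebraMap_le c)

theorem finite_L (H : IsKummer m α x y) (D : Divisor k F) : Module.Finite k D.L := by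
  refine Divisor.finite_L H.finite_residue ?_ D
  obtain ⟨Q, hQ⟩ := H.exists_zeros
  have hle : (0 : Divisor k F).L ≤ LinearMap.range (Algebra.linearMap k F) := by
    intro f hf
    obtain ⟨c, rfl⟩ := H.eq_algebraMap_of_mem_L hQ (n := fun _ => 0)
      (fun _ => Nat.pos_of_ne_zero H.m_ne_zero) (fun i hi => by
        rw [Finset.filter_false_of_mem fun t _ => by omega]
        simp) (E := 0) (by simp) (by simp) hf
    exact ⟨c, rfl⟩
  exact Submodule.finiteDimensional_of_le hle

/-- The independent functions `y^j x^i` with `i < m` and `m j + r i ≤ m N` lie in the space. For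
fixed `i` the condition is `j ≤ N - l_{m-i}`, because `l_{m-i} = ⌈r i / m⌉`. -/
theorem le_ell_single_infinity (H : IsKummer m α x y) {R : Place k F} (hR : R.IsAtInfinity x y)
    {N : ℕ} (hN : r ≤ N) :
    m * N + 1 ≤ Divisor.ell (Finsupp.single R ((m * N : ℕ) : ℤ)) + kummerGenus r m := by
  rw [← sum_lnum_add H.pos H.m_ne_zero hN]
  gcongr
  have := H.finite_L (Finsupp.single R ((m * N : ℕ) : ℤ))
  obtain ⟨hRx, hRy, -⟩ := H.place_at_infinity.2 R hR
  let w : Fin m → ℕ := fun i => N + 1 - lnum r m (m - i)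
  let v : (Σ i : Fin m, Fin (w i)) → F := fun s => y ^ (s.2 : ℕ) * x ^ (s.1 : ℕ)
  have hv : ∀ s, v s ∈ Divisor.L (Finsupp.single R ((m * N : ℕ) : ℤ)) := by
    rintro ⟨i, j⟩ P
    by_cases hP : P.val y ≤ 1
    · have hPR : R ≠ P := by
        rintro rfl
        exact (H.isAtInfinity_iff.1 hR).not_ge hP
      rw [Finsupp.single_eq_of_ne hPR.symm, exp_zero, map_mul, map_pow, map_pow]
      exact mul_le_one' (pow_le_one' hP _) (pow_le_one' (H.val_x_le_one hP) _)
    · obtain rfl := H.eq_infinity hR (not_le.1 hP)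
      rw [Finsupp.single_eq_same, map_mul, map_pow, map_pow, hRx, hRy, ← exp_nsmul, ← exp_nsmul,
        ← exp_add, exp_le_exp, nsmul_eq_mul, nsmul_eq_mul]
      have hj : (j : ℕ) < N + 1 - lnum r m (m - i) := j.2
      have hi := i.2
      have h1 : (j : ℕ) + lnum r m (m - i) ≤ N := by omega
      have h2 : r * (m - i) / m ≤ r := by
        refine Nat.div_le_of_le_mul ?_
        rw [mul_comm m r]
        exact Nat.mul_le_mul_left r (Nat.sub_le _ _)
      have h3 : lnum r m (m - i) + r * (m - i) / m = r := Nat.sub_add_cancel h2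
      have h4 : m * (r * (m - i) / m) ≤ r * (m - i) := Nat.mul_div_le _ _
      have h5 : r * (m - i) + r * i = m * r := by
        rw [← mul_add, Nat.sub_add_cancel hi.le, mul_comm]
      have h6 := Nat.mul_le_mul_left m h1
      rw [mul_add] at h6
      have h7 : m * lnum r m (m - i) + m * (r * (m - i) / m) = m * r := by
        rw [← mul_add, h3]
      have h8 : j * m + i * r ≤ m * N := by
        have : (j : ℕ) * m = m * j := mul_comm _ _
        have : (i : ℕ) * r = r * i := mul_comm _ _
        omega
      exact_mod_cast h8
  have hli : LinearIndependent k v := by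
    rw [Fintype.linearIndependent_iff]
    intro g hg s
    have h := H.aeval_eq_zero_of_sum_eq_zero
      (g := fun i => ∑ j : Fin (w i), monomial (j : ℕ) (g ⟨i, j⟩)) (by
        rw [← hg, Fintype.sum_sigma]
        refine Finset.sum_congr rfl fun i _ => ?_
        rw [map_sum, Finset.sum_mul]
        refine Finset.sum_congr rfl fun j _ => ?_
        rw [aeval_monomial, Algebra.smul_def, mul_assoc]) s.1
    have h' := congrArg (fun p => coeff p (s.2 : ℕ)) h
    simp only [finsetSum_coeff, coeff_monomial, coeff_zero] at h'
    rw [Finset.sum_eq_single s.2 (fun j _ hj => if_neg fun e => hj (Fin.ext e))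
      (fun hs => absurd (Finset.mem_univ _) hs), if_pos rfl] at h'
    exact h'
  have hli' : LinearIndependent k
      (fun s => (⟨v s, hv s⟩ : Divisor.L (Finsupp.single R ((m * N : ℕ) : ℤ)))) :=
    LinearIndependent.of_comp (Submodule.subtype _) hli
  have hcard := hli'.fintype_card_le_finrank
  simp only [Fintype.card_sigma, Fintype.card_fin] at hcard
  exact hcard

/-- Riemann's inequality. -/
theorem riemann (H : IsKummer m α x y) (D : Divisor k F) :
    D.deg + 1 - D.ell ≤ kummerGenus r m := by
  classical
  have := H.finiteDimensional
  have := H.isSeparable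
  obtain ⟨R, hR⟩ := H.exists_isAtInfinity
  obtain ⟨-, hRy, -⟩ := H.place_at_infinity.2 R hR
  have hRdeg := H.degree_of_isAtInfinity hR
  have hmono : ∀ {D D' : Divisor k F}, D ≤ D' → D'.deg + 1 - D'.ell ≤ kummerGenus r m →
      D.deg + 1 - D.ell ≤ kummerGenus r m := by
    intro D D' hle h
    have := Divisor.deg_sub_ell_mono H.finite_residue H.finite_L hle
    linarith
  have hbase : ∀ n : ℤ, Divisor.deg (Finsupp.single R n : Divisor k F) + 1 -
      (Divisor.ell (Finsupp.single R n) : ℤ) ≤ kummerGenus r m := by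
    intro n
    have hm1 : 1 ≤ m := Nat.pos_of_ne_zero H.m_ne_zero
    -- The summand `r` serves only to meet the condition `r ≤ N` of the monomial count.
    have hle : (Finsupp.single R n : Divisor k F) ≤
        Finsupp.single R ((m * (n.toNat + r) : ℕ) : ℤ) := by
      refine Finsupp.single_mono ?_
      have h1 := Nat.mul_le_mul_right (n.toNat + r) hm1
      have h2 := Int.self_le_toNat n
      zify at h1
      push_cast
      linarith
    refine hmono hle ?_
    have h := H.le_ell_single_infinity hR (N := n.toNat + r) (by omega)
    rw [Divisor.deg_single, hRdeg]
    zify at h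
    push_cast at h ⊢
    linarith
  -- The divisor of `p(y)` is `Z - m (deg p) R`. So `W + Z + n R` is equivalent to `W + (n + m deg
  -- p) R`, and the bound carries over from `W` to `W + Z`.
  have hstep : ∀ W : Divisor k F,
      (∀ n : ℤ, (W + Finsupp.single R n : Divisor k F).deg + 1 -
        (Divisor.ell (W + Finsupp.single R n) : ℤ) ≤ kummerGenus r m) →
      ∀ (p : k[X]) (Z : Divisor k F),
        (∀ Q : Place k F, Q.val y ≤ 1 → Q.val (aeval y p) = exp (-Z Q)) →
        (∀ Q : Place k F, 1 < Q.val y → Z Q = 0) → p ≠ 0 →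
        Z.deg = m * p.natDegree →
      ∀ n : ℤ, (W + Z + Finsupp.single R n : Divisor k F).deg + 1 -
        (Divisor.ell (W + Z + Finsupp.single R n) : ℤ) ≤ kummerGenus r m := by
    intro W hW p Z hZ1 hZ2 hp hZdeg n
    have h := hW (n + m * p.natDegree)
    have := H.finite_L (W + Z + Finsupp.single R n)
    have hell := Divisor.ell_le_ell_of_val_eq (k := k) (F := F)
      (D := W + Finsupp.single R (n + m * p.natDegree)) (D' := W + Z + Finsupp.single R n)
      (z := (aeval y p)⁻¹) (inv_ne_zero (H.aeval_ne_zero hp)) (fun P => by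
        rw [map_inv₀]
        by_cases hP : P.val y ≤ 1
        · have hPR : R ≠ P := by
            rintro rfl
            exact (H.isAtInfinity_iff.1 hR).not_ge hP
          rw [hZ1 P hP, ← exp_neg]
          simp [Finsupp.single_eq_of_ne hPR.symm]
        · obtain rfl := H.eq_infinity hR (not_le.1 hP)
          rw [Place.val_aeval_of_one_lt (not_le.1 hP) hp, hRy, ← exp_nsmul, ← exp_neg, exp_inj]
          simp [hZ2 P (not_le.1 hP)]
          ring)
    rw [Divisor.deg_add, Divisor.deg_single, hRdeg] at h ⊢
    rw [Divisor.deg_add, hZdeg]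
    zify at hell
    push_cast at h ⊢
    linarith
  -- Up to a multiple of `R`, every `D` lies below a sum `W` of divisors `Z` as above; adding such a
  -- `W` to any `U` preserves the bound.
  have hmain : ∀ D : Divisor k F, ∃ (W : Divisor k F) (n₀ : ℤ), D ≤ W + Finsupp.single R n₀ ∧
      ∀ U : Divisor k F, (∀ n : ℤ, (U + Finsupp.single R n : Divisor k F).deg + 1 -
        (Divisor.ell (U + Finsupp.single R n) : ℤ) ≤ kummerGenus r m) →
      ∀ n : ℤ, (U + W + Finsupp.single R n : Divisor k F).deg + 1 -
        (Divisor.ell (U + W + Finsupp.single R n) : ℤ) ≤ kummerGenus r m := by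
    intro D
    induction D using Finsupp.induction_linear with
    | zero => exact ⟨0, 0, by simp, fun U hU n => by simpa using hU n⟩
    | add D₁ D₂ h₁ h₂ =>
      obtain ⟨W₁, n₁, hle₁, hW₁⟩ := h₁
      obtain ⟨W₂, n₂, hle₂, hW₂⟩ := h₂
      refine ⟨W₁ + W₂, n₁ + n₂, ?_, fun U hU n => ?_⟩
      · rw [Finsupp.single_add, add_add_add_comm]
        exact add_le_add hle₁ hle₂
      · rw [← add_assoc]
        exact hW₂ _ (hW₁ _ hU) n
    | single P a =>
      by_cases hP : P.val y ≤ 1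
      · obtain ⟨-, p, Z, hZP, hZ0, hZ1, hZ2, hp, hZdeg⟩ :=
          exists_zeroDivisor_polynomial H.transcendental P hP
        rw [H.finrank_eq] at hZdeg
        refine ⟨a.toNat • Z, 0, ?_, ?_⟩
        · intro Q
          rw [Finsupp.single_zero, add_zero, Finsupp.smul_apply, nsmul_eq_mul,
            Finsupp.single_apply]
          have h1 := Int.self_le_toNat a
          have h2 : (0 : ℤ) ≤ a.toNat := by positivity
          split_ifs with hPQ
          · subst hPQ
            nlinarith
          · exact mul_nonneg h2 (hZ0 Q)
        · intro U hU
          generalize a.toNat = N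
          induction N with
          | zero => simpa using hU
          | succ N ih =>
            rw [succ_nsmul, ← add_assoc]
            exact hstep _ ih p Z hZ1 hZ2 hp hZdeg
      · obtain rfl := H.eq_infinity hR (not_le.1 hP)
        exact ⟨0, a, by simp, fun U hU n => by simpa using hU n⟩
  obtain ⟨W, n, hle, hW⟩ := hmain D
  refine hmono hle ?_
  have := hW 0 (fun n => by simpa using hbase n) n
  rwa [zero_add] at this

end IsKummer

end Riemann

/-! ### The numbers `l_j` and `s_j` -/

section Combinatorics

variable {r m : ℕ}

theorem lnum_antitone (r m : ℕ) : Antitone (lnum r m) := fun _ _ hij =>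
  Nat.sub_le_sub_left (Nat.div_le_div_right (Nat.mul_le_mul_left r hij)) r

theorem lnum_le_one {j : ℕ} (hm : m ≠ 0) (hj : gam r m < j) : lnum r m j ≤ 1 := by
  have h1 : m ≤ j + m / r := by
    unfold gam at hj
    omega
  have h2 : r * (m / r) ≤ m := Nat.mul_div_le m r
  have h3 := Nat.mul_le_mul_left r h1
  rw [mul_add] at h3
  have h4 : r - 1 ≤ r * j / m := by
    rw [Nat.le_div_iff_mul_le (Nat.pos_of_ne_zero hm), Nat.sub_mul, one_mul]
    omega
  unfold lnum
  omega

theorem gam_lt (hm : m ≠ 0) : gam r m < m := by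
  unfold gam
  generalize m / r = d
  omega

/-- The sum telescopes; the last term `l_γ - 1` accounts for the `- 1`. -/
theorem sum_snum (hr : 0 < r) (hm : m ≠ 0) {i : ℕ} (hi : i ≤ gam r m) :
    ∑ j ∈ Finset.Icc i (gam r m), snum r m j = lnum r m i - 1 := by
  induction hi using Nat.decreasingInduction with
  | self => simp [snum]
  | of_succ i hi ih =>
    rw [← Finset.add_sum_Ioc_eq_sum_Icc hi.le, ← Finset.Icc_succ_left_eq_Ioc]
    simp only [Order.succ_eq_add_one]
    rw [ih, snum, if_pos hi]
    have h1 := lnum_antitone r m (Nat.le_succ i)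
    have h2 := one_le_lnum (r := r) (m := m) (j := i + 1) hr (by
      have := gam_lt (r := r) hm
      omega)
    simp only [Nat.succ_eq_add_one] at h1
    omega

/-- Terms with `j > γ` vanish since `l_j ≤ 1` there. For the rest, write `l_i - 1 = ∑_{j ≥ i} s_j`
and exchange the sums: each `s_j` is counted `j` times. -/
theorem kummerGenus_eq (hr : 0 < r) (hm : m ≠ 0) :
    kummerGenus r m = ∑ j ∈ Finset.Icc 1 (gam r m), j * snum r m j := by
  have h1 : kummerGenus r m = ∑ j ∈ Finset.Icc 1 (gam r m), (lnum r m j - 1) := by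
    refine (Finset.sum_subset (Finset.Icc_subset_Icc_right ?_) fun j hj hj' => ?_).symm
    · have := gam_lt (r := r) hm
      omega
    · rw [Finset.mem_Icc] at hj hj'
      have := lnum_le_one (r := r) hm (j := j) (by omega)
      omega
  rw [h1, Finset.sum_congr rfl fun j hj => (sum_snum hr hm (Finset.mem_Icc.1 hj).2).symm,
    Finset.sum_comm' (t' := Finset.Icc 1 (gam r m)) (s' := fun j => Finset.Icc 1 j)]
  · simp
  · intro i j
    simp only [Finset.mem_Icc]
    omega

theorem card_idx_filter_le (hr : 0 < r) (hm : m ≠ 0) {j : ℕ} (hj : j ≤ gam r m) :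
    ((idx r m).filter fun p => j ≤ p.1).card ≤ lnum r m j - 1 := by
  rw [← sum_snum hr hm hj]
  have hsub : (idx r m).filter (fun p => j ≤ p.1) ⊆
      (Finset.Icc j (gam r m)).sigma fun j => Finset.Icc 1 (snum r m j) := by
    intro p hp
    simp only [idx, Finset.mem_filter, Finset.mem_sigma, Finset.mem_Icc] at hp ⊢
    exact ⟨⟨hp.2, hp.1.1.2⟩, hp.1.2⟩
  refine (Finset.card_le_card hsub).trans ?_
  rw [Finset.card_sigma]
  simp

theorem mem_idx {p : Σ _ : ℕ, ℕ} (hp : p ∈ idx r m) : 1 ≤ p.1 ∧ p.1 ≤ gam r m := by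
  simp only [idx, Finset.mem_sigma, Finset.mem_Icc] at hp
  exact hp.1

/-- The count is at most `l_{m-i} - 1 = ⌈r i / m⌉ - 1` if `m - i ≤ γ`, and zero otherwise. This
supplies the root count needed in `eq_zero_of_val_le`. -/
theorem mul_card_idx_filter_le (hr : 0 < r) (hm : m ≠ 0) {i : ℕ} (hi : i < m) :
    m * ((idx r m).filter fun p => m - i ≤ p.1).card ≤ r * i := by
  by_cases hj : m - i ≤ gam r m
  · have h1 := Nat.mul_le_mul_left m (card_idx_filter_le hr hm hj)
    refine h1.trans ?_
    have h2 : r * (m - i) < m * (r * (m - i) / m) + m := by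
      have := Nat.div_add_mod (r * (m - i)) m
      have := Nat.mod_lt (r * (m - i)) (Nat.pos_of_ne_zero hm)
      omega
    have h3 : r * (m - i) + r * i = m * r := by
      rw [← mul_add, Nat.sub_add_cancel hi.le, mul_comm]
    rw [lnum, Nat.mul_sub, Nat.mul_sub]
    omega
  · rw [Finset.filter_false_of_mem fun p hp => by
      have := (mem_idx hp).2
      omega]
    simp

theorem exists_injOn_idx (hr : 0 < r) (hm : m ≠ 0) :
    ∃ β : (Σ _ : ℕ, ℕ) → Fin r, Set.InjOn β (idx r m) := by
  classical
  have hcard : (idx r m).card ≤ r := by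
    by_cases h : 1 ≤ gam r m
    · have h1 := card_idx_filter_le hr hm h
      rw [Finset.filter_true_of_mem fun p hp => (mem_idx hp).1] at h1
      have h2 : lnum r m 1 ≤ r := Nat.sub_le _ _
      omega
    · rw [idx, Finset.Icc_eq_empty h]
      simp
  obtain ⟨e⟩ := Function.Embedding.nonempty_of_card_le
    (α := idx r m) (β := Fin r) (by simpa using hcard)
  refine ⟨fun p => if hp : p ∈ idx r m then e ⟨p, hp⟩ else ⟨0, hr⟩, fun p hp q hq h => ?_⟩
  have hp' : p ∈ idx r m := hp
  have hq' : q ∈ idx r m := hq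
  simp only [dif_pos hp', dif_pos hq'] at h
  exact congrArg Subtype.val (e.injective h)

end Combinatorics

/-! ### The genus and the non-special divisors -/

section Nonspecial

variable {k F : Type*} [Field k] [Field F] [Algebra k F] {r m : ℕ} {α : Fin r → k} {x y : F}

/-- The effective divisor `∑ j, j ∑ i, Q (β (j, i))`. -/
def poleDivisor (m : ℕ) (Q : Fin r → Place k F) (β : (Σ _ : ℕ, ℕ) → Fin r) : Divisor k F :=
  ∑ j ∈ Finset.Icc 1 (gam r m), (j : ℤ) •
    ∑ i ∈ Finset.Icc 1 (snum r m j), Finsupp.single (Q (β ⟨j, i⟩)) (1 : ℤ)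

theorem poleDivisor_eq (Q : Fin r → Place k F) (β : (Σ _ : ℕ, ℕ) → Fin r) :
    poleDivisor m Q β = ∑ p ∈ idx r m, Finsupp.single (Q (β p)) (p.1 : ℤ) := by
  rw [poleDivisor, idx, Finset.sum_sigma]
  refine Finset.sum_congr rfl fun j _ => ?_
  rw [Finset.smul_sum]
  exact Finset.sum_congr rfl fun i _ => by simp

theorem poleDivisor_apply [DecidableEq (Place k F)] (Q : Fin r → Place k F)
    (β : (Σ _ : ℕ, ℕ) → Fin r) (P : Place k F) :
    poleDivisor m Q β P = ∑ p ∈ idx r m, if Q (β p) = P then (p.1 : ℤ) else 0 := by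
  rw [poleDivisor_eq, Finsupp.finsetSum_apply]
  exact Finset.sum_congr rfl fun p _ => Finsupp.single_apply

theorem poleDivisor_apply_eq_zero {Q : Fin r → Place k F} {β : (Σ _ : ℕ, ℕ) → Fin r}
    {P : Place k F} (h : ∀ p ∈ idx r m, P ≠ Q (β p)) : poleDivisor m Q β P = 0 := by
  classical
  rw [poleDivisor_apply]
  exact Finset.sum_eq_zero fun p hp => if_neg (h p hp).symm

namespace IsKummer

theorem injective_zeros (H : IsKummer m α x y) {Q : Fin r → Place k F}
    (hQ : ∀ t, (Q t).IsAt x y 0 (α t)) : Function.Injective Q := by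
  intro s t hst
  have h := (hQ t).2
  rw [← hst] at h
  exact H.injective (Place.eq_of_sub_lt (hQ s).2 h)

theorem deg_poleDivisor (H : IsKummer m α x y) {Q : Fin r → Place k F}
    (hQ : ∀ t, (Q t).IsAt x y 0 (α t)) (β : (Σ _ : ℕ, ℕ) → Fin r) :
    (poleDivisor m Q β).deg = kummerGenus r m := by
  rw [poleDivisor_eq, Divisor.deg_sum, kummerGenus_eq H.pos H.m_ne_zero, idx, Finset.sum_sigma]
  push_cast
  refine Finset.sum_congr rfl fun j _ => ?_
  simp [H.degree_of_isAt (hQ _), mul_comm]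

theorem eq_algebraMap_of_mem_L_poleDivisor (H : IsKummer m α x y) {Q : Fin r → Place k F}
    (hQ : ∀ t, (Q t).IsAt x y 0 (α t)) {β : (Σ _ : ℕ, ℕ) → Fin r} (hβ : Set.InjOn β (idx r m))
    {f : F} (hf : f ∈ (poleDivisor m Q β).L) : ∃ c : k, f = algebraMap k F c := by
  classical
  -- The coefficient of the divisor at `Q t`; since `β` is injective on the index set, at most one
  -- summand is nonzero.
  let n : Fin r → ℕ := fun t => ∑ p ∈ idx r m, if β p = t then p.1 else 0
  have hn1 : ∀ p ∈ idx r m, n (β p) = p.1 := by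
    intro p hp
    simp only [n]
    rw [Finset.sum_eq_single p (fun q hq hqp => if_neg fun h => hqp (hβ hq hp h))
      (fun h => absurd hp h), if_pos rfl]
  have hn2 : ∀ t, 1 ≤ n t → ∃ p ∈ idx r m, β p = t ∧ n t = p.1 := by
    intro t ht
    by_contra hcon
    push Not at hcon
    have : n t = 0 := Finset.sum_eq_zero fun p hp => if_neg fun h =>
      hcon p hp h (h ▸ hn1 p hp)
    omega
  have hm := H.m_ne_zero
  refine H.eq_algebraMap_of_mem_L hQ (n := n) (fun t => ?_) (fun i hi => ?_) (fun t => ?_)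
    (fun P hP => poleDivisor_apply_eq_zero fun p _ => hP (β p)) hf
  · have hg := gam_lt (r := r) hm
    by_cases ht : 1 ≤ n t
    · obtain ⟨p, hp, -, hpt⟩ := hn2 t ht
      have := (mem_idx hp).2
      omega
    · omega
  · refine le_trans (Nat.mul_le_mul_left m ?_) (mul_card_idx_filter_le H.pos hm hi)
    refine (Finset.card_le_card fun t ht => ?_).trans
      (Finset.card_image_le (s := (idx r m).filter fun p => m - i ≤ p.1) (f := β))
    rw [Finset.mem_filter] at ht
    obtain ⟨p, hp, hpt, hpn⟩ := hn2 t (by omega)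
    exact Finset.mem_image.2 ⟨p, Finset.mem_filter.2 ⟨hp, by omega⟩, hpt⟩
  · rw [poleDivisor_apply]
    simp only [n]
    push_cast
    exact Finset.sum_congr rfl fun p _ => by simp [(H.injective_zeros hQ).eq_iff]

/-- The divisors `∑ j, j ∑ i, Q (β (j, i)) - P` have degree `g - 1` and no sections. -/
theorem ell_eq_zero (H : IsKummer m α x y) {Q : Fin r → Place k F}
    (hQ : ∀ t, (Q t).IsAt x y 0 (α t)) {β : (Σ _ : ℕ, ℕ) → Fin r} (hβ : Set.InjOn β (idx r m))
    {P : Place k F} (hP : ∀ p ∈ idx r m, P ≠ Q (β p)) :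
    Divisor.ell (poleDivisor m Q β - Finsupp.single P 1) = 0 := by
  classical
  have hbot : Divisor.L (poleDivisor m Q β - Finsupp.single P 1) = ⊥ := by
    rw [eq_bot_iff]
    intro f hf
    have hle : poleDivisor m Q β - Finsupp.single P 1 ≤ poleDivisor m Q β :=
      sub_le_self _ (Finsupp.single_nonneg.2 zero_le_one)
    obtain ⟨c, rfl⟩ := H.eq_algebraMap_of_mem_L_poleDivisor hQ hβ (Divisor.L_mono hle hf)
    have h := hf P
    rw [Finsupp.sub_apply, poleDivisor_apply_eq_zero hP, Finsupp.single_eq_same] at h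
    have hlt : P.val (algebraMap k F c) < 1 := h.trans_lt (by
      rw [← exp_zero, exp_lt_exp]
      norm_num)
    rw [P.val_algebraMap_lt_one_iff.1 hlt]
    simp
  rw [Divisor.ell, hbot]
  simp

theorem ne_of_isAtInfinity (H : IsKummer m α x y) {P Q : Place k F} (hP : P.IsAtInfinity x y)
    {a b : k} (hQ : Q.IsAt x y a b) : P ≠ Q := by
  rintro rfl
  exact (H.isAtInfinity_iff.1 hP).not_ge (Place.val_le_one_of_sub_lt hQ.2)

/-- The maximum is attained at `E - P_∞`, which has degree `kummerGenus r m - 1` and no sections. -/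
theorem isGreatest_kummerGenus (H : IsKummer m α x y) :
    IsGreatest (genusSet k F) (kummerGenus r m) := by
  refine ⟨?_, ?_⟩
  · obtain ⟨Q, hQ⟩ := H.exists_zeros
    obtain ⟨β, hβ⟩ := exists_injOn_idx H.pos H.m_ne_zero
    obtain ⟨R, hR⟩ := H.exists_isAtInfinity
    refine ⟨poleDivisor m Q β - Finsupp.single R 1, ?_⟩
    change Divisor.deg _ + 1 - (Divisor.ell _ : ℤ) = _
    rw [H.ell_eq_zero hQ hβ fun p _ => H.ne_of_isAtInfinity hR (hQ _), Divisor.deg_sub,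
      H.deg_poleDivisor hQ, Divisor.deg_single, H.degree_of_isAtInfinity hR]
    simp
  · rintro _ ⟨D, rfl⟩
    exact H.riemann D

theorem genus_eq (H : IsKummer m α x y) : genus k F = kummerGenus r m :=
  H.isGreatest_kummerGenus.csSup_eq

theorem isNonspecial_sub_single (H : IsKummer m α x y) {Q : Fin r → Place k F}
    (hQ : ∀ t, (Q t).IsAt x y 0 (α t)) {β : (Σ _ : ℕ, ℕ) → Fin r} (hβ : Set.InjOn β (idx r m))
    {P : Place k F} (hP : ∀ p ∈ idx r m, P ≠ Q (β p)) (hdeg : P.degree = 1) :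
    Divisor.IsNonspecial (poleDivisor m Q β - Finsupp.single P 1) ∧
      Divisor.deg (poleDivisor m Q β - Finsupp.single P 1) = genus k F - 1 := by
  have h : Divisor.deg (poleDivisor m Q β - Finsupp.single P 1) = genus k F - 1 := by
    rw [Divisor.deg_sub, H.deg_poleDivisor hQ, Divisor.deg_single, hdeg, H.genus_eq]
    simp
  refine ⟨?_, h⟩
  rw [Divisor.IsNonspecial, Divisor.specialityIndex, h, H.ell_eq_zero hQ hβ hP]
  simp

end IsKummer

end Nonspecial

end KummerCurve

end

open KummerCurve in
theorem mainTheorem2 {k F : Type*} [Field k] [Finite k] [Field F] [Algebra k F]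
    (r m : ℕ) (hr : 0 < r) (hm : (m : k) ≠ 0) (hrm : Nat.Coprime r m)
    (α : Fin r → k) (hα : Function.Injective α)
    (x y : F) (hy : Transcendental k y)
    (hxy : ∏ i, (y - algebraMap k F (α i)) = x ^ m)
    (hF : IntermediateField.adjoin k {x, y} = ⊤) :
    -- the points `P_{ab}` and `P_∞` and the genus are well defined
    (∀ a b : k, ∏ i, (b - α i) = a ^ m → ∃! P : Place k F, P.IsAt x y a b) ∧
    (∃! P : Place k F, P.IsAtInfinity x y) ∧
    IsGreatest (genusSet k F) (genus k F) ∧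
    -- the explicit divisors; `Q t` is the point `P_{0 b}` with `b = α t`, and
    -- `β` selects the pairwise distinct roots `b_{j_i}`
    (∀ Q : Fin r → Place k F, (∀ t, (Q t).IsAt x y 0 (α t)) →
      ∀ β : (Σ _ : ℕ, ℕ) → Fin r, Set.InjOn β (idx r m) →
      ∀ P : Place k F,
        ((∃ a b : k, P.IsAt x y a b ∧ (a ≠ 0 ∨ ∀ p ∈ idx r m, b ≠ α (β p))) ∨
          P.IsAtInfinity x y) →
        ∀ A : Divisor k F,
          A = (∑ j ∈ Finset.Icc 1 (gam r m), (j : ℤ) •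
                ∑ i ∈ Finset.Icc 1 (snum r m j), Finsupp.single (Q (β ⟨j, i⟩)) (1 : ℤ))
              - Finsupp.single P 1 →
          A.IsNonspecial ∧ A.deg = genus k F - 1) ∧
    -- existence of non-special divisors of degree `g - 1` supported on `Supp((x)_0) ∪ {P_{ab}}`
    (∀ (a b : k) (P : Place k F), a ≠ 0 → P.IsAt x y a b →
      ∃ A : Divisor k F, A.IsNonspecial ∧ A.deg = genus k F - 1 ∧
        (A.support : Set (Place k F)) ⊆ zeroSupport k x ∪ {P} ∧ P ∈ A.support) := by
  have H : IsKummer m α x y := ⟨hr, hm, hrm, hα, hy, hxy, hF⟩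
  have hne : ∀ (Q : Fin r → Place k F), (∀ t, (Q t).IsAt x y 0 (α t)) → ∀ (a b : k)
      (P : Place k F), P.IsAt x y a b → ∀ t, a ≠ 0 ∨ b ≠ α t → P ≠ Q t := by
    rintro Q hQ a b P hP t hab rfl
    rcases hab with h | h
    · exact h (Place.eq_of_sub_lt hP.1 (hQ t).1)
    · exact h (Place.eq_of_sub_lt hP.2 (hQ t).2)
  refine ⟨fun a b hab => ?_, ?_, ?_, ?_, ?_⟩
  · obtain ⟨P, hP⟩ := H.exists_isAt hab
    exact ⟨P, hP, fun P' hP' => (H.place_at_point hab).1 hP' hP⟩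
  · obtain ⟨R, hR⟩ := H.exists_isAtInfinity
    exact ⟨R, hR, fun R' hR' => H.place_at_infinity.1 hR' hR⟩
  · rw [H.genus_eq]
    exact H.isGreatest_kummerGenus
  · rintro Q hQ β hβ P hP A rfl
    rcases hP with ⟨a, b, hPab, hab⟩ | hP
    · exact H.isNonspecial_sub_single hQ hβ (fun p hp => hne Q hQ a b P hPab (β p)
        (hab.imp_right fun h => h p hp)) (H.degree_of_isAt hPab)
    · exact H.isNonspecial_sub_single hQ hβ (fun p _ => H.ne_of_isAtInfinity hP (hQ _))
        (H.degree_of_isAtInfinity hP)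
  · intro a b P ha hP
    classical
    obtain ⟨Q, hQ⟩ := H.exists_zeros
    obtain ⟨β, hβ⟩ := exists_injOn_idx H.pos H.m_ne_zero
    -- `x` takes the value `a ≠ 0` at `P`, so `P` is none of the zeros `Q t` and keeps coefficient
    -- `-1` in the divisor.
    have hPQ : ∀ t, P ≠ Q t := fun t => hne Q hQ a b P hP t (Or.inl ha)
    obtain ⟨h1, h2⟩ := H.isNonspecial_sub_single hQ hβ (fun p _ => hPQ (β p))
      (H.degree_of_isAt hP)
    refine ⟨_, h1, h2, fun R hR => ?_, ?_⟩
    · by_contra hcon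
      rw [Set.mem_union, not_or, Set.mem_singleton_iff] at hcon
      refine (Finsupp.mem_support_iff.1 hR) ?_
      rw [Finsupp.sub_apply, Finsupp.single_eq_of_ne hcon.2, sub_zero]
      refine poleDivisor_apply_eq_zero fun p _ => ?_
      rintro rfl
      have hx := (hQ (β p)).1
      rw [map_zero, sub_zero] at hx
      exact hcon.1 hx
    · rw [Finsupp.mem_support_iff, Finsupp.sub_apply, Finsupp.single_eq_same,
        poleDivisor_apply_eq_zero fun p _ => hPQ (β p)]
      norm_num
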